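/- Let $0<\alpha,\beta<1$ and $0<\gamma\le 1$ with $\alpha+\beta+\gamma>2$, and put $$a=\frac{\alpha+\beta-\gamma}{2},\qquad b=\frac{\alpha+\beta+\gamma-2}{2},\qquad c=\alpha .$$ Let $F(a,b,c;z)$ be the Gaussian hypergeometric function, i.e. the analytic continuation to $\mathbb C\setminus[1,\infty)$ of $\sum_{n\ge0}\frac{(a)_n(b)_n}{(c)_n}\frac{z^n}{n!}$, $|z|<1$, where $(x)_0=1$, $(x)_n=x(x+1)\cdots(x+n-1)$. Let $$\varphi_1(z)=F(a,b,c;z),\qquad \varphi_2(z)=F(a,b,a+b-c+1;1-z),$$ $$K_1=-\frac{\Gamma(c-a)\Gamma(c-b)}{\Gamma(c)\Gamma(c-a-b)},\qquad K_2=-\frac{\Gamma(a+1-c)\Gamma(b+1-c)}{\Gamma(1-c)\Gamma(a+b+1-c)},$$ and let $$M(z)=K_1|\varphi_1(z)|^2+K_2|\varphi_2(z)|^2+2\,\mathrm{Re}\big(\varphi_1(z)\varphi_2(\bar z)\big)$$ for $z\in\mathbb C\setminus((-\infty,0]\cup[1,\infty))$, extended by continuity across the cuts. (Thus $M$ is the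 denominator in the explicit formula $\lambda_{\alpha,\beta,\gamma}(z)=|z|^{-\alpha}|1-z|^{-\beta}K_3/M(z)$, $K_3$ a constant, for the generalized hyperbolic density of orders $\alpha,\beta,\gamma$ at $0,1,\infty$.) Write $\partial=\partial/\partial z$ and $\bar\partial=\partial/\partial\bar z$ for the Wirtinger derivatives. Then on $\mathbb C\setminus((-\infty,0]\cup[1,\infty))$ $$M(z)=(K_1\varphi_1(\bar z)+\varphi_2(\bar z))\varphi_1(z)+(K_2\varphi_2(\bar z)+\varphi_1(\bar z))\varphi_2(z),$$ the function $M$ is $C^\infty$ (in the real sense) on $0<|z|<1$, and, as $z\to0$, $z\ne0$: (1) $\displaystyle\lim_{z\to0}\partial M(z)=\frac{ab}{c}\Big(K_1-\frac1{K_2}\Big)$ if $0<\alpha<\tfrac12$; (2) $\displaystyle\partial M(z)=2ab\Big(K_1-\frac1{K_2}\Big)+2K_2\Big(\frac{\Gamma(c)\Gamma(a+b-c+1)}{\Gamma(a)\Gamma(b)}\Big)^2\frac{\bar z}{|z|}+O\big(|z|^{1/2}\big)$ if $\alpha=\tfrac12$; (3) $\displaystyle\lim_{z\to0}z^n|z|^{2\alpha-2}\partial^nM(z)=\frac{(-1)^{n-1}(c)_{n-1}K_2}{1-c}\Big(\frac{\Gamma(c)\Gamma(a+b-c+1)}{\Gamma(a)\Gamma(b)}\Big)^2$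 for every $n\ge2$ if $0<\alpha\le\tfrac12$, and for every $n\ge1$ if $\tfrac12<\alpha<1$; (4) $\displaystyle\lim_{z\to0}\bar z^mz^n|z|^{2\alpha-2}\bar\partial^m\partial^nM(z)=(-1)^{n+m}(c)_{n-1}(c)_{m-1}K_2\Big(\frac{\Gamma(c)\Gamma(a+b-c+1)}{\Gamma(a)\Gamma(b)}\Big)^2$ for all $m,n\ge1$. -/

import Mathlib

open Complex Filter Topology Asymptotics
open scoped ContDiff ComplexConjugate

namespace HypMetric

/-- The slit plane `ℂ \ [1, ∞)`. -/
def slitAtOne : Set ℂ := {z | 1 - z ∈ slitPlane}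

/-- `f` is an analytic continuation to `ℂ \ [1, ∞)` of the Gaussian hypergeometric series
`∑ (a)ₙ (b)ₙ / (c)ₙ * zⁿ / n!`, `|z| < 1`. -/
def IsHypergeometricContinuation (a b c : ℂ) (f : ℂ → ℂ) : Prop :=
  AnalyticOnNhd ℂ f slitAtOne ∧ Set.EqOn f (ordinaryHypergeometric a b c) (Metric.ball 0 1)

open Classical in
/-- The Gaussian hypergeometric function `F(a, b, c; z)`, continued analytically to
`ℂ \ [1, ∞)`. The continuation exists if `c ≠ 0, -1, -2, …`, and its values on the (connected)
slit plane are unique; the values on the cut `[1, ∞)` are irrelevant and never used. -/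
noncomputable def F (a b c : ℂ) : ℂ → ℂ :=
  if h : ∃ f, IsHypergeometricContinuation a b c f then h.choose else ordinaryHypergeometric a b c

/-- `φ₁(z) = F(a, b, c; z)`. -/
noncomputable def φ₁ (a b c : ℝ) (z : ℂ) : ℂ := F a b c z

/-- `φ₂(z) = F(a, b, a + b - c + 1; 1 - z)`. -/
noncomputable def φ₂ (a b c : ℝ) (z : ℂ) : ℂ := F a b (a + b - c + 1) (1 - z)

noncomputable def K₁ (a b c : ℝ) : ℝ :=
  -(Real.Gamma (c - a) * Real.Gamma (c - b) / (Real.Gamma c * Real.Gamma (c - a - b)))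

noncomputable def K₂ (a b c : ℝ) : ℝ :=
  -(Real.Gamma (a + 1 - c) * Real.Gamma (b + 1 - c) /
    (Real.Gamma (1 - c) * Real.Gamma (a + b + 1 - c)))

/-- The doubly slit plane `ℂ \ ((-∞, 0] ∪ [1, ∞))`, on which `φ₁`, `φ₂` are both analytic. -/
def doublySlit : Set ℂ := slitPlane ∩ slitAtOne

/-- `K₁ |φ₁(z)|² + K₂ |φ₂(z)|² + 2 Re (φ₁(z) φ₂(z̄))`, meaningful on `doublySlit`. -/
noncomputable def denomFormula (a b c : ℝ) (z : ℂ) : ℝ :=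
  K₁ a b c * ‖φ₁ a b c z‖ ^ 2 + K₂ a b c * ‖φ₂ a b c z‖ ^ 2
    + 2 * (φ₁ a b c z * φ₂ a b c (conj z)).re

/-- The denominator `M` of the hyperbolic density on the twice-punctured plane: the formula on
the doubly slit plane, extended by continuity across the two cuts. -/
noncomputable def M (a b c : ℝ) : ℂ → ℝ := extendFrom doublySlit (denomFormula a b c)

/-- The Wirtinger derivative `∂ = (∂/∂x - i ∂/∂y) / 2`. -/
noncomputable def del (f : ℂ → ℂ) (z : ℂ) : ℂ :=
  (fderiv ℝ f z 1 - I * fderiv ℝ f z I) / 2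

/-- The Wirtinger derivative `∂̄ = (∂/∂x + i ∂/∂y) / 2`. -/
noncomputable def delbar (f : ℂ → ℂ) (z : ℂ) : ℂ :=
  (fderiv ℝ f z 1 + I * fderiv ℝ f z I) / 2

/-- `∂̄ᵐ ∂ⁿ M`. -/
noncomputable def derivM (a b c : ℝ) (m n : ℕ) : ℂ → ℂ :=
  delbar^[m] (del^[n] fun z => (M a b c z : ℂ))

/-- The Pochhammer symbol `(x)ₙ = x (x + 1) ⋯ (x + n - 1)`. -/
noncomputable def poch (x : ℝ) (n : ℕ) : ℝ := (ascPochhammer ℝ n).eval x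

/-- `Γ(c) Γ(a + b - c + 1) / (Γ(a) Γ(b))`. -/
noncomputable def gammaQuot (a b c : ℝ) : ℝ :=
  Real.Gamma c * Real.Gamma (a + b - c + 1) / (Real.Gamma a * Real.Gamma b)

end HypMetric

/-! Near the puncture $0$ the mixed expression $M$ becomes diagonal when it is rewritten in the
Frobenius basis at $0$. With `φ₃` $=F(a-c+1,b-c+1,2-c;\cdot)$ and $G$ for `gammaQuot`, the
connection formula reads $\varphi_2=-K_2^{-1}\varphi_1-\frac{G}{1-c}z^{1-c}\varphi_3$. The
coefficient $-1/K_2$ is exactly the one that cancels the cross terms in $M$, whatever $K_1$ is, so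
$$M=\Big(K_1-\frac1{K_2}\Big)|\varphi_1|^2+K_2\Big(\frac{G}{1-c}\Big)^2|z|^{2(1-c)}|\varphi_3|^2 .$$
This is `denomFormula_eq_localFormula`. The right side has no branch cut, so it is also the
continuous extension of $M$ and is smooth on the punctured disc.

The connection formula comes from Euler's integral and the differential equation. Abel's identity
makes weighted Wronskians constant, so $\varphi_2$ is a combination of the two Frobenius solutions.
Its coefficients are read off from the limits at $0$ and $1$, with Gauss's evaluation and the
reflection formula for $\Gamma$ (`connection_formula_ball_half`, `gauss_sum_relation`).

The derivatives are then explicit. On $|z|^{2s}h\,\bar k$ with $h,k$ holomorphic, $\partial$ acts on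
$h$ alone and $\bar\partial$ on $k$ alone, each through $h\mapsto z^{-s}(z^sh)'$
(`hasFDerivAt_powForm`). Applied $n$ times, this operator gives $z^{-n}$ times an analytic function
with value $s(s-1)\cdots(s-n+1)h(0)$ at $0$ (`exists_iterate_twistedDeriv_eq`). With $s=1-c$ the
second term dominates when $m+n>2(1-c)$. Only $\partial M$ with $c\le\frac12$ needs a separate look,
since there the first term contributes as well. -/

namespace HypMetric

open MeasureTheory ProbabilityTheory

/-! ### Moments of the Beta distribution -/

lemma measurable_betaPDF (p q : ℝ) : Measurable (betaPDF p q) :=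
  (measurable_betaPDFReal p q).ennreal_ofReal

lemma ae_betaMeasure_mem_Ioo (p q : ℝ) : ∀ᵐ t ∂betaMeasure p q, t ∈ Set.Ioo (0 : ℝ) 1 := by
  rw [betaMeasure, ae_withDensity_iff (measurable_betaPDF p q)]
  refine ae_of_all _ fun t ht => ?_
  by_contra h
  rw [betaPDF_eq, if_neg (show ¬(0 < t ∧ t < 1) from h)] at ht
  simp at ht

lemma betaPDF_toReal_eq {p q : ℝ} (hp : 0 < p) (hq : 0 < q) (t : ℝ) :
    (betaPDF p q t).toReal = betaPDFReal p q t := by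
  rw [betaPDF, ENNReal.toReal_ofReal]
  by_cases h : 0 < t ∧ t < 1
  · exact (betaPDFReal_pos h.1 h.2 hp hq).le
  · rw [betaPDFReal, if_neg h]

lemma integral_betaMeasure {p q : ℝ} (hp : 0 < p) (hq : 0 < q) (f : ℝ → ℝ) :
    ∫ t, f t ∂betaMeasure p q = ∫ t, betaPDFReal p q t * f t := by
  rw [betaMeasure, integral_withDensity_eq_integral_toReal_smul
    (measurable_betaPDF p q) (by simp [betaPDF])]
  simp [betaPDF_toReal_eq hp hq]

lemma integrable_betaMeasure_iff {p q : ℝ} (hp : 0 < p) (hq : 0 < q) (f : ℝ → ℝ) :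
    Integrable f (betaMeasure p q) ↔ Integrable fun t => betaPDFReal p q t * f t := by
  rw [betaMeasure, integrable_withDensity_iff_integrable_smul'
    (measurable_betaPDF p q) (by simp [betaPDF])]
  simp [betaPDF_toReal_eq hp hq]

/-- The Beta densities form a family closed, up to normalisation, under multiplication by powers of
$t$ and $1-t$. All Beta moments below follow from this, because every member has total mass $1$. -/
lemma betaPDFReal_mul_rpow {p q r s : ℝ} (hp : 0 < p) (hq : 0 < q) (hr : 0 < p + r)
    (hs : 0 < q + s) (t : ℝ) :
    betaPDFReal p q t * (t ^ r * (1 - t) ^ s)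
      = beta (p + r) (q + s) / beta p q * betaPDFReal (p + r) (q + s) t := by
  unfold betaPDFReal
  split_ifs with h
  · have h1 : 0 < 1 - t := by linarith [h.2]
    have hb := beta_pos hp hq
    have hb' := beta_pos hr hs
    rw [show p + r - 1 = (p - 1) + r by ring, show q + s - 1 = (q - 1) + s by ring,
      Real.rpow_add h.1, Real.rpow_add h1]
    field_simp
  · simp

lemma integral_betaMeasure_rpow {p q r s : ℝ} (hp : 0 < p) (hq : 0 < q) (hr : 0 < p + r)
    (hs : 0 < q + s) :
    ∫ t, t ^ r * (1 - t) ^ s ∂betaMeasure p q = beta (p + r) (q + s) / beta p q := by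
  have : IsProbabilityMeasure (betaMeasure (p + r) (q + s)) := isProbabilityMeasureBeta hr hs
  have h1 := integral_betaMeasure hr hs fun _ => 1
  simp only [integral_const, probReal_univ, smul_eq_mul, mul_one] at h1
  rw [integral_betaMeasure hp hq]
  simp_rw [betaPDFReal_mul_rpow hp hq hr hs]
  rw [integral_const_mul, ← h1, mul_one]

lemma integrable_betaMeasure_rpow {p q r s : ℝ} (hp : 0 < p) (hq : 0 < q) (hr : 0 < p + r)
    (hs : 0 < q + s) :
    Integrable (fun t => t ^ r * (1 - t) ^ s) (betaMeasure p q) := by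
  have : IsProbabilityMeasure (betaMeasure (p + r) (q + s)) := isProbabilityMeasureBeta hr hs
  have h1 := (integrable_betaMeasure_iff hr hs fun _ => 1).1 (integrable_const 1)
  simp only [mul_one] at h1
  rw [integrable_betaMeasure_iff hp hq]
  simp_rw [betaPDFReal_mul_rpow hp hq hr hs]
  exact h1.const_mul _

lemma Gamma_add_natCast {x : ℝ} (hx : 0 < x) (n : ℕ) :
    Real.Gamma (x + n) = (ascPochhammer ℝ n).eval x * Real.Gamma x := by
  induction n with
  | zero => simp
  | succ n ih =>
    rw [Nat.cast_succ, ← add_assoc, Real.Gamma_add_one (by positivity), ih,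
      ascPochhammer_succ_eval]
    ring

lemma integral_betaMeasure_pow {p q : ℝ} (hp : 0 < p) (hq : 0 < q) (n : ℕ) :
    ∫ t, t ^ n ∂betaMeasure p q
      = (ascPochhammer ℝ n).eval p / (ascPochhammer ℝ n).eval (p + q) := by
  have h := integral_betaMeasure_rpow (r := n) (s := 0) hp hq (by positivity) (by simpa)
  simp only [Real.rpow_natCast, Real.rpow_zero, mul_one, add_zero] at h
  rw [h, beta, beta, add_right_comm, Gamma_add_natCast hp, Gamma_add_natCast (add_pos hp hq)]
  have h1 := Real.Gamma_pos_of_pos hp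
  have h2 := Real.Gamma_pos_of_pos hq
  have h3 := Real.Gamma_pos_of_pos (add_pos hp hq)
  have h4 := ascPochhammer_pos n (p + q) (add_pos hp hq)
  field_simp

/-! ### Euler's integral: analytic continuation, symmetry and the value at 1 -/

/-- Euler's integral for the hypergeometric function. -/
noncomputable def eulerIntegral (a b c : ℝ) (z : ℂ) : ℂ :=
  ∫ t, (1 - z * (t : ℂ)) ^ (-(a : ℂ)) ∂betaMeasure b (c - b)

lemma isOpen_slitAtOne : IsOpen slitAtOne :=
  isOpen_slitPlane.preimage (continuous_const.sub continuous_id)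

lemma one_sub_mul_mem_slitPlane {z : ℂ} (hz : z ∈ slitAtOne) {t : ℝ} (ht : t ∈ Set.Icc (0 : ℝ) 1) :
    1 - z * (t : ℂ) ∈ slitPlane := by
  have h := starConvex_one_slitPlane hz (sub_nonneg.2 ht.2) ht.1 (sub_add_cancel 1 t)
  convert h using 1
  simp only [real_smul, ofReal_sub, ofReal_one]
  ring

lemma isPreconnected_slitAtOne : IsPreconnected slitAtOne := by
  have h : StarConvex ℝ (0 : ℂ) slitAtOne := by
    intro z hz s t hs ht hst
    have := one_sub_mul_mem_slitPlane hz (t := t) ⟨ht, by linarith⟩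
    simp only [slitAtOne, Set.mem_ofPred_eq, smul_zero, zero_add, real_smul]
    rwa [mul_comm]
  exact (h.isPathConnected (show (1 : ℂ) - 0 ∈ slitPlane by simp)).isConnected.isPreconnected

lemma ball_subset_slitAtOne : Metric.ball (0 : ℂ) 1 ⊆ slitAtOne := by
  intro z hz
  rw [mem_ball_zero_iff] at hz
  exact Or.inl (by simpa using (re_le_norm z).trans_lt hz)

/-- For $z$ off the cut and $t\in[0,1]$ the base $1-zt$ stays in the slit plane, so the integrand
and its $z$-derivative are bounded on a compact neighbourhood times $[0,1]$. Differentiation under a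
probability measure is then allowed. -/
lemma differentiableOn_eulerIntegral {a b c : ℝ} (hb : 0 < b) (hcb : 0 < c - b) :
    DifferentiableOn ℂ (eulerIntegral a b c) slitAtOne := by
  have : IsProbabilityMeasure (betaMeasure b (c - b)) := isProbabilityMeasureBeta hb hcb
  intro z₀ hz₀
  obtain ⟨ε, hε, hball⟩ := Metric.nhds_basis_closedBall.mem_iff.1 (isOpen_slitAtOne.mem_nhds hz₀)
  have hcont : ∀ e : ℂ, ContinuousOn (fun x : ℂ × ℝ => (1 - x.1 * (x.2 : ℂ)) ^ e)
      (Metric.closedBall z₀ ε ×ˢ Set.Icc 0 1) := by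
    intro e
    refine ContinuousOn.cpow (by fun_prop) continuousOn_const fun x hx => ?_
    exact one_sub_mul_mem_slitPlane (hball hx.1) hx.2
  have hK : IsCompact (Metric.closedBall z₀ ε ×ˢ Set.Icc (0 : ℝ) 1) :=
    (isCompact_closedBall _ _).prod isCompact_Icc
  have hmeas : ∀ (e z : ℂ), AEStronglyMeasurable (fun t : ℝ => (1 - z * (t : ℂ)) ^ e)
      (betaMeasure b (c - b)) := fun e z =>
    (by fun_prop : Measurable fun t : ℝ => (1 - z * (t : ℂ)) ^ e).aestronglyMeasurable
  obtain ⟨C₀, hC₀⟩ := hK.exists_bound_of_continuousOn (hcont (-(a : ℂ)))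
  obtain ⟨C, hC⟩ := hK.exists_bound_of_continuousOn
    (f := fun x : ℂ × ℝ => -(a : ℂ) * (1 - x.1 * (x.2 : ℂ)) ^ (-(a : ℂ) - 1) * (-(x.2 : ℂ)))
    ((continuousOn_const.mul (hcont _)).mul (by fun_prop))
  have key := hasDerivAt_integral_of_dominated_loc_of_deriv_le (μ := betaMeasure b (c - b))
    (F := fun z (t : ℝ) => (1 - z * (t : ℂ)) ^ (-(a : ℂ)))
    (F' := fun z (t : ℝ) => -(a : ℂ) * (1 - z * (t : ℂ)) ^ (-(a : ℂ) - 1) * (-(t : ℂ)))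
    (bound := fun _ => C) (Metric.closedBall_mem_nhds z₀ hε)
    (Eventually.of_forall fun z => hmeas _ z)
    (Integrable.mono' (integrable_const C₀) (hmeas _ _)
      ((ae_betaMeasure_mem_Ioo _ _).mono fun t ht =>
        hC₀ (z₀, t) ⟨Metric.mem_closedBall_self hε.le, Set.Ioo_subset_Icc_self ht⟩))
    (((hmeas _ _).const_mul _).mul
      (by fun_prop : Measurable fun t : ℝ => -(t : ℂ)).aestronglyMeasurable)
    ((ae_betaMeasure_mem_Ioo _ _).mono fun t ht z hz =>
        hC (z, t) ⟨hz, Set.Ioo_subset_Icc_self ht⟩)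
    (integrable_const C)
    ((ae_betaMeasure_mem_Ioo _ _).mono fun t ht z hz => by
      have h1 : HasDerivAt (fun z : ℂ => 1 - z * (t : ℂ)) (-(t : ℂ)) z := by
        simpa using ((hasDerivAt_id z).mul_const (t : ℂ)).const_sub 1
      exact h1.cpow_const (one_sub_mul_mem_slitPlane (hball hz) (Set.Ioo_subset_Icc_self ht)))
  exact key.2.differentiableAt.differentiableWithinAt

lemma one_sub_cpow_neg_hasSum (a : ℝ) {x : ℂ} (hx : ‖x‖ < 1) :
    HasSum (fun n : ℕ => ((n.factorial : ℂ)⁻¹ * (ascPochhammer ℂ n).eval (a : ℂ)) * x ^ n)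
        ((1 - x) ^ (-(a : ℂ))) ∧
      Summable fun n : ℕ => ‖((n.factorial : ℂ)⁻¹ * (ascPochhammer ℂ n).eval (a : ℂ)) * x ^ n‖ := by
  have h := one_div_one_sub_cpow_hasFPowerSeriesOnBall_zero (a : ℂ)
  have hx' : x ∈ Metric.eball (0 : ℂ) 1 := by simpa [← ofReal_norm] using hx
  have hcoef : ∀ n : ℕ, Ring.choose ((a : ℂ) + n - 1) n
      = (n.factorial : ℂ)⁻¹ * (ascPochhammer ℂ n).eval (a : ℂ) := by
    intro n
    have := Ring.factorial_nsmul_multichoose_eq_ascPochhammer (a : ℂ) n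
    rw [Ring.multichoose_eq, Polynomial.ascPochhammer_smeval_eq_eval, nsmul_eq_mul] at this
    rw [← this, inv_mul_cancel_left₀ (by exact_mod_cast n.factorial_ne_zero)]
  refine ⟨?_, ?_⟩
  · have := h.hasSum hx'
    simpa [FormalMultilinearSeries.ofScalars, hcoef, cpow_neg, mul_comm] using this
  · have := FormalMultilinearSeries.summable_norm_apply _
      (Metric.eball_subset_eball h.r_le hx')
    simpa [FormalMultilinearSeries.ofScalars, hcoef, mul_comm] using this

lemma ascPochhammer_eval_ofReal (x : ℝ) (n : ℕ) :
    (ascPochhammer ℂ n).eval (x : ℂ) = (((ascPochhammer ℝ n).eval x : ℝ) : ℂ) := by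
  induction n with
  | zero => simp
  | succ n ih => simp [ascPochhammer_succ_eval, ih]

/-- Expand $(1-zt)^{-a}$ by the binomial series and integrate term by term: the $n$-th moment of the
measure is $(b)_n/(c)_n$. -/
lemma eulerIntegral_eq_ordinaryHypergeometric {a b c : ℝ} (hb : 0 < b) (hcb : 0 < c - b) {z : ℂ}
    (hz : ‖z‖ < 1) : eulerIntegral a b c z = ordinaryHypergeometric (a : ℂ) (b : ℂ) (c : ℂ) z := by
  have : IsProbabilityMeasure (betaMeasure b (c - b)) := isProbabilityMeasureBeta hb hcb
  set u : ℕ → ℂ := fun n => (n.factorial : ℂ)⁻¹ * (ascPochhammer ℂ n).eval (a : ℂ) with hu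
  have hle : ∀ n : ℕ, ∀ t ∈ Set.Ioo (0 : ℝ) 1, ‖u n * (z * (t : ℂ)) ^ n‖ ≤ ‖u n * z ^ n‖ := by
    intro n t ht
    rw [mul_pow, ← mul_assoc, norm_mul (u n * z ^ n)]
    refine mul_le_of_le_one_right (norm_nonneg _) ?_
    rw [norm_pow, norm_real, Real.norm_of_nonneg ht.1.le]
    exact pow_le_one₀ ht.1.le ht.2.le
  have hint : ∀ n : ℕ, Integrable (fun t : ℝ => u n * (z * (t : ℂ)) ^ n) (betaMeasure b (c - b)) :=
    fun n => Integrable.mono' (integrable_const ‖u n * z ^ n‖)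
      (by fun_prop : Measurable fun t : ℝ => u n * (z * (t : ℂ)) ^ n).aestronglyMeasurable
      ((ae_betaMeasure_mem_Ioo _ _).mono (hle n))
  have hsum := hasSum_integral_of_summable_integral_norm hint
    (Summable.of_nonneg_of_le (fun n => integral_nonneg fun t => norm_nonneg _)
      (fun n => by
        have := integral_mono_ae (hint n).norm (integrable_const ‖u n * z ^ n‖)
          ((ae_betaMeasure_mem_Ioo _ _).mono (hle n))
        simpa only [integral_const, probReal_univ, one_smul] using this)
      (one_sub_cpow_neg_hasSum a hz).2)
  have hlhs : ∫ t : ℝ, ∑' n, u n * (z * (t : ℂ)) ^ n ∂betaMeasure b (c - b)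
      = eulerIntegral a b c z := by
    refine integral_congr_ae ((ae_betaMeasure_mem_Ioo _ _).mono fun t ht => ?_)
    refine (one_sub_cpow_neg_hasSum a ?_).1.tsum_eq
    rw [norm_mul, norm_real, Real.norm_of_nonneg ht.1.le]
    exact (mul_le_of_le_one_right (norm_nonneg z) ht.2.le).trans_lt hz
  rw [← hlhs, ← hsum.tsum_eq, ordinaryHypergeometric_eq_tsum]
  refine tsum_congr fun n => ?_
  have hmom : ∫ t : ℝ, u n * (z * (t : ℂ)) ^ n ∂betaMeasure b (c - b)
      = u n * z ^ n * ((∫ t : ℝ, t ^ n ∂betaMeasure b (c - b) : ℝ) : ℂ) := by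
    rw [← integral_complex_ofReal, ← integral_const_mul]
    simp [mul_pow, mul_assoc]
  rw [hmom, integral_betaMeasure_pow hb hcb, add_sub_cancel, smul_eq_mul, hu]
  simp only [ascPochhammer_eval_ofReal, ofReal_div]
  ring

lemma isHypergeometricContinuation_eulerIntegral {a b c : ℝ} (hb : 0 < b) (hcb : 0 < c - b) :
    IsHypergeometricContinuation a b c (eulerIntegral a b c) :=
  ⟨(differentiableOn_eulerIntegral hb hcb).analyticOnNhd isOpen_slitAtOne, fun z hz =>
    eulerIntegral_eq_ordinaryHypergeometric hb hcb (by simpa using hz)⟩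

/-- The domain is star-shaped about $0$, hence connected, and the identity theorem applies. This
identifies the chosen function `F` with Euler's integral. -/
lemma IsHypergeometricContinuation.eqOn {a b c : ℂ} {f g : ℂ → ℂ}
    (hf : IsHypergeometricContinuation a b c f) (hg : IsHypergeometricContinuation a b c g) :
    Set.EqOn f g slitAtOne := by
  refine hf.1.eqOn_of_preconnected_of_eventuallyEq hg.1 isPreconnected_slitAtOne
    (z₀ := 0) (by simp [slitAtOne]) ?_
  filter_upwards [Metric.ball_mem_nhds (0 : ℂ) one_pos] with z hz
  rw [hf.2 hz, hg.2 hz]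

lemma isHypergeometricContinuation_F {a b c : ℝ} (hb : 0 < b) (hcb : 0 < c - b) :
    IsHypergeometricContinuation a b c (F a b c) := by
  have h : ∃ f, IsHypergeometricContinuation a b c f :=
    ⟨_, isHypergeometricContinuation_eulerIntegral hb hcb⟩
  rw [F, dif_pos h]
  exact h.choose_spec

lemma F_eq_eulerIntegral {a b c : ℝ} (hb : 0 < b) (hcb : 0 < c - b) {z : ℂ} (hz : z ∈ slitAtOne) :
    F a b c z = eulerIntegral a b c z :=
  (isHypergeometricContinuation_F hb hcb).eqOn
    (isHypergeometricContinuation_eulerIntegral hb hcb) hz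

lemma eulerIntegral_conj (a b c : ℝ) {z : ℂ} (hz : z ∈ slitAtOne) :
    eulerIntegral a b c (conj z) = conj (eulerIntegral a b c z) := by
  rw [eulerIntegral, eulerIntegral, ← integral_conj]
  refine integral_congr_ae ((ae_betaMeasure_mem_Ioo _ _).mono fun t ht => ?_)
  have h := one_sub_mul_mem_slitPlane hz (Set.Ioo_subset_Icc_self ht)
  have h2 := conj_cpow (1 - z * (t : ℂ)) (-(a : ℂ)) (slitPlane_arg_ne_pi h)
  simpa using h2

lemma conj_mem_slitAtOne {z : ℂ} (hz : z ∈ slitAtOne) : conj z ∈ slitAtOne := by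
  simpa [slitAtOne, mem_slitPlane_iff] using hz

lemma F_conj {a b c : ℝ} (hb : 0 < b) (hcb : 0 < c - b) {z : ℂ} (hz : z ∈ slitAtOne) :
    F a b c (conj z) = conj (F a b c z) := by
  rw [F_eq_eulerIntegral hb hcb hz, F_eq_eulerIntegral hb hcb (conj_mem_slitAtOne hz),
    eulerIntegral_conj a b c hz]

/-- Since $a\ge0$, the integrands for $0<x<1$ are dominated by $(1-t)^{-a}$, which is integrable
because $c-a-b>0$. The limit is a ratio of Beta functions. -/
lemma tendsto_eulerIntegral_one {a b c : ℝ} (ha : 0 ≤ a) (hb : 0 < b) (hcb : 0 < c - b)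
    (hcab : 0 < c - a - b) :
    Tendsto (fun x : ℝ => eulerIntegral a b c x) (𝓝[<] 1)
      (𝓝 ((Real.Gamma c * Real.Gamma (c - a - b) / (Real.Gamma (c - a) * Real.Gamma (c - b)) : ℝ)
        : ℂ)) := by
  have hval : ((Real.Gamma c * Real.Gamma (c - a - b) /
      (Real.Gamma (c - a) * Real.Gamma (c - b)) : ℝ) : ℂ)
      = ∫ t : ℝ, (((1 - t) ^ (-a) : ℝ) : ℂ) ∂betaMeasure b (c - b) := by
    rw [integral_complex_ofReal]
    congr 1
    have h := integral_betaMeasure_rpow (r := 0) (s := -a) hb hcb (by simpa) (by linarith)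
    simp only [Real.rpow_zero, one_mul, add_zero] at h
    rw [h, beta, beta, show b + (c - b + -a) = c - a by ring, add_sub_cancel,
      show c - b + -a = c - a - b by ring]
    have h1 := Real.Gamma_pos_of_pos hb
    have h2 := Real.Gamma_pos_of_pos hcb
    have h3 := Real.Gamma_pos_of_pos (show 0 < c - a by linarith)
    have h4 := Real.Gamma_pos_of_pos (show 0 < c by linarith)
    field_simp
  rw [hval]
  have hint := integrable_betaMeasure_rpow (r := 0) (s := -a) hb hcb (by simpa) (by linarith)
  simp only [Real.rpow_zero, one_mul] at hint
  have hx : ∀ᶠ x : ℝ in 𝓝[<] 1, x ∈ Set.Ioo (0 : ℝ) 1 := Ioo_mem_nhdsLT one_pos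
  refine tendsto_integral_filter_of_dominated_convergence (fun t => (1 - t) ^ (-a)) ?_ ?_ hint ?_
  · exact Eventually.of_forall fun x =>
      (by fun_prop : Measurable fun t : ℝ =>
        (1 - (x : ℂ) * (t : ℂ)) ^ (-(a : ℂ))).aestronglyMeasurable
  · filter_upwards [hx] with x hx
    filter_upwards [ae_betaMeasure_mem_Ioo b (c - b)] with t ht
    have h1 : 1 - t ≤ 1 - x * t := by nlinarith [ht.1, hx.2]
    have h2 : 0 < 1 - t := by linarith [ht.2]
    have h3 : (1 - (x : ℂ) * (t : ℂ)) ^ (-(a : ℂ)) = (((1 - x * t) ^ (-a) : ℝ) : ℂ) := by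
      rw [ofReal_cpow (by linarith)]
      push_cast
      rfl
    rw [h3, norm_real, Real.norm_of_nonneg (Real.rpow_nonneg (by linarith) _)]
    exact Real.rpow_le_rpow_of_nonpos h2 h1 (by linarith)
  · filter_upwards [ae_betaMeasure_mem_Ioo b (c - b)] with t ht
    have h2 : 0 < 1 - t := by linarith [ht.2]
    have h3 : (((1 - t) ^ (-a) : ℝ) : ℂ) = (1 - ((1 : ℝ) : ℂ) * (t : ℂ)) ^ (-(a : ℂ)) := by
      rw [ofReal_cpow h2.le]
      push_cast
      simp
    rw [h3]
    have hc : ContinuousAt (fun x : ℝ => (1 - (x : ℂ) * (t : ℂ)) ^ (-(a : ℂ))) 1 := by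
      refine ContinuousAt.cpow (by fun_prop) continuousAt_const (Or.inl ?_)
      simpa using ht.2
    exact hc.tendsto.mono_left nhdsWithin_le_nhds

/-! ### The hypergeometric equation, its Frobenius solutions and their Wronskian -/

lemma exists_hasFPowerSeriesOnBall_deriv {f : ℂ → ℂ} {p : FormalMultilinearSeries ℂ ℂ ℂ}
    {r : ENNReal} (h : HasFPowerSeriesOnBall f p 0 r) :
    ∃ q : FormalMultilinearSeries ℂ ℂ ℂ, HasFPowerSeriesOnBall (deriv f) q 0 r ∧
      ∀ n, q.coeff n = (n + 1) * p.coeff (n + 1) := by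
  refine ⟨_, (ContinuousLinearMap.apply ℂ ℂ (1 : ℂ)).comp_hasFPowerSeriesOnBall h.fderiv,
    fun n => ?_⟩
  have := p.derivSeries_coeff_one n
  change (p.derivSeries.coeff n) 1 = _
  rw [this, nsmul_eq_mul]
  push_cast
  rfl

lemma hasSum_coeff_mul_pow {f : ℂ → ℂ} {p : FormalMultilinearSeries ℂ ℂ ℂ}
    (h : HasFPowerSeriesOnBall f p 0 1) {z : ℂ} (hz : ‖z‖ < 1) :
    HasSum (fun n => p.coeff n * z ^ n) (f z) := by
  have hz' : z ∈ Metric.eball (0 : ℂ) 1 := by simpa [← ofReal_norm] using hz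
  simpa [FormalMultilinearSeries.apply_eq_pow_smul_coeff, mul_comm] using h.hasSum hz'

lemma hasSum_mul_pow_shift {v : ℕ → ℂ} {z s : ℂ} (h : HasSum (fun n => v n * z ^ n) s) :
    HasSum (fun n => (if n = 0 then 0 else v (n - 1)) * z ^ n) (z * s) := by
  rw [← hasSum_nat_add_iff' 1]
  simp only [Finset.range_one, Finset.sum_singleton, if_true, zero_mul, sub_zero]
  refine (h.mul_left z).congr_fun fun n => ?_
  rw [if_neg n.succ_ne_zero, Nat.add_sub_cancel]
  ring

/-- `y` solves the hypergeometric equation on `s`, with first and second derivatives `y'`, `y''`. -/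
structure IsHypergeometricSolution (a b c : ℂ) (s : Set ℂ) (y y' y'' : ℂ → ℂ) : Prop where
  hasDerivAt : ∀ z ∈ s, HasDerivAt y (y' z) z
  hasDerivAt' : ∀ z ∈ s, HasDerivAt y' (y'' z) z
  eq_zero : ∀ z ∈ s, z * (1 - z) * y'' z + (c - (a + b + 1) * z) * y' z - a * b * y z = 0

lemma IsHypergeometricSolution.mono {a b c : ℂ} {s t : Set ℂ} {y y' y'' : ℂ → ℂ}
    (h : IsHypergeometricSolution a b c s y y' y'') (hts : t ⊆ s) :
    IsHypergeometricSolution a b c t y y' y'' :=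
  ⟨fun z hz => h.1 z (hts hz), fun z hz => h.2 z (hts hz), fun z hz => h.3 z (hts hz)⟩

lemma hasFPowerSeriesOnBall_ordinaryHypergeometric {a b c : ℝ} (ha : 0 < a) (hb : 0 < b)
    (hc : 0 < c) :
    HasFPowerSeriesOnBall (ordinaryHypergeometric (a : ℂ) (b : ℂ) (c : ℂ) : ℂ → ℂ)
      (ordinaryHypergeometricSeries ℂ (a : ℂ) (b : ℂ) (c : ℂ)) 0 1 := by
  have hne : ∀ {x : ℝ}, 0 < x → ∀ k : ℕ, (k : ℂ) ≠ -(x : ℂ) := by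
    intro x hx k h
    have : (k : ℝ) = -x := by exact_mod_cast h
    linarith [k.cast_nonneg (α := ℝ)]
  have hr := ordinaryHypergeometricSeries_radius_eq_one ℂ (a : ℂ) (b : ℂ) (c : ℂ)
    fun k => ⟨hne ha k, hne hb k, hne hc k⟩
  have := (ordinaryHypergeometricSeries ℂ (a : ℂ) (b : ℂ) (c : ℂ)).hasFPowerSeriesOnBall
    (by rw [hr]; exact one_pos)
  rwa [hr] at this

lemma analyticOnNhd_ordinaryHypergeometric {a b c : ℝ} (ha : 0 < a) (hb : 0 < b) (hc : 0 < c) :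
    AnalyticOnNhd ℂ (ordinaryHypergeometric (a : ℂ) (b : ℂ) (c : ℂ) : ℂ → ℂ)
      (Metric.ball 0 1) := by
  have := (hasFPowerSeriesOnBall_ordinaryHypergeometric ha hb hc).analyticOnNhd
  rwa [show (1 : ENNReal) = ENNReal.ofReal 1 by simp, Metric.eball_ofReal] at this

lemma coeff_ordinaryHypergeometricSeries (a b c : ℂ) (n : ℕ) :
    (ordinaryHypergeometricSeries ℂ a b c).coeff n = ordinaryHypergeometricCoefficient a b c n := by
  rw [ordinaryHypergeometricSeries, FormalMultilinearSeries.coeff_ofScalars]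

lemma ordinaryHypergeometricCoefficient_succ (a b : ℂ) {c : ℝ} (hc : 0 < c) (n : ℕ) :
    (n + 1) * (c + n) * ordinaryHypergeometricCoefficient a b (c : ℂ) (n + 1)
      = (a + n) * (b + n) * ordinaryHypergeometricCoefficient a b (c : ℂ) n := by
  have h1 : (n : ℂ) + 1 ≠ 0 := by exact_mod_cast n.succ_ne_zero
  have h2 : (c : ℂ) + n ≠ 0 := by
    exact_mod_cast (add_pos_of_pos_of_nonneg hc n.cast_nonneg).ne'
  have h3 : (ascPochhammer ℂ n).eval (c : ℂ) ≠ 0 := by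
    rw [ascPochhammer_eval_ofReal]
    exact_mod_cast (ascPochhammer_pos n c hc).ne'
  have h4 : (n.factorial : ℂ) ≠ 0 := by exact_mod_cast n.factorial_ne_zero
  simp only [ordinaryHypergeometricCoefficient, ascPochhammer_succ_eval, Nat.factorial_succ,
    Nat.cast_mul, Nat.cast_succ]
  field_simp

lemma isHypergeometricSolution_ordinaryHypergeometric {a b c : ℝ} (ha : 0 < a) (hb : 0 < b)
    (hc : 0 < c) :
    IsHypergeometricSolution a b c (Metric.ball 0 1) (ordinaryHypergeometric (a : ℂ) (b : ℂ) (c : ℂ))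
      (deriv (ordinaryHypergeometric (a : ℂ) (b : ℂ) (c : ℂ)))
      (deriv (deriv (ordinaryHypergeometric (a : ℂ) (b : ℂ) (c : ℂ)))) := by
  have han := analyticOnNhd_ordinaryHypergeometric ha hb hc
  refine ⟨fun z hz => (han z hz).differentiableAt.hasDerivAt,
    fun z hz => (han.deriv z hz).differentiableAt.hasDerivAt, fun z hz => ?_⟩
  rw [mem_ball_zero_iff] at hz
  have h0 := hasFPowerSeriesOnBall_ordinaryHypergeometric ha hb hc
  obtain ⟨q, h1, hq⟩ := exists_hasFPowerSeriesOnBall_deriv h0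
  obtain ⟨r, h2, hr⟩ := exists_hasFPowerSeriesOnBall_deriv h1
  have s0 := hasSum_coeff_mul_pow h0 hz
  have s1 := hasSum_coeff_mul_pow h1 hz
  have s2 := hasSum_coeff_mul_pow h2 hz
  have t1 := hasSum_mul_pow_shift s1
  have t2 := hasSum_mul_pow_shift s2
  have t3 := hasSum_mul_pow_shift t2
  have hsum := ((((t2.sub t3).add (s1.mul_left (c : ℂ))).sub
    (t1.mul_left ((a : ℂ) + b + 1))).sub (s0.mul_left ((a : ℂ) * b)))
  have key := hsum.unique (hasSum_zero.congr_fun ?_)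
  · rw [← key]
    ring
  · intro n
    have hrec := ordinaryHypergeometricCoefficient_succ (a : ℂ) (b : ℂ) hc n
    simp only [hr, hq, coeff_ordinaryHypergeometricSeries]
    -- The terms $zy''$, $z^2y''$ and $zy'$ are shifted series whose missing low coefficients are
    -- $0$, so degrees $0$ and $1$ are checked apart. In every degree the identity is the two-term
    -- recurrence of the coefficients.
    rcases n with _ | _ | n
    · simp only [Nat.cast_zero, add_zero, zero_add] at hrec ⊢
      simp only [if_true]
      linear_combination hrec
    · simp only [Nat.cast_zero, zero_add, Nat.cast_one, if_true, if_false, one_ne_zero,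
        Nat.sub_self] at hrec ⊢
      linear_combination z ^ 1 * hrec
    · simp only [Nat.add_eq_zero_iff, one_ne_zero, and_false, if_false, Nat.add_sub_cancel,
        Nat.cast_add, Nat.cast_one] at hrec ⊢
      linear_combination z ^ (n + 1 + 1) * hrec

/-- The reflection $z\mapsto1-z$ exchanges the singular points $0$ and $1$ and replaces $c$ by
$a+b-c+1$. This is why $\varphi_2$ solves the same equation as $\varphi_1$. -/
lemma IsHypergeometricSolution.comp_one_sub {a b c : ℂ} {s : Set ℂ} {y y' y'' : ℂ → ℂ}
    (h : IsHypergeometricSolution a b (a + b - c + 1) s y y' y'') :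
    IsHypergeometricSolution a b c ((fun z => 1 - z) ⁻¹' s) (fun z => y (1 - z))
      (fun z => -y' (1 - z)) (fun z => y'' (1 - z)) := by
  have h1 : ∀ z : ℂ, HasDerivAt (fun z : ℂ => 1 - z) (-1) z := fun z => by
    simpa using (hasDerivAt_id z).const_sub 1
  refine ⟨fun z hz => ?_, fun z hz => ?_, fun z hz => ?_⟩
  · simpa [Function.comp_def] using (h.hasDerivAt _ hz).comp z (h1 z)
  · simpa [Function.comp_def] using ((h.hasDerivAt' _ hz).comp z (h1 z)).fun_neg
  · have := h.eq_zero _ hz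
    linear_combination this

lemma hasDerivAt_cpow_const_slitPlane {z : ℂ} (hz : z ∈ slitPlane) (e : ℂ) :
    HasDerivAt (fun z : ℂ => z ^ e) (e * z ^ e / z) z := by
  have := (hasDerivAt_id z).cpow_const (c := e) hz
  rw [id, cpow_sub _ _ (slitPlane_ne_zero hz), cpow_one] at this
  exact this.congr_deriv (by ring)

/-- The second Frobenius solution at `0`. -/
lemma IsHypergeometricSolution.cpow_mul {a b c : ℂ} {s : Set ℂ} {g g' g'' : ℂ → ℂ}
    (h : IsHypergeometricSolution (a - c + 1) (b - c + 1) (2 - c) s g g' g'')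
    (hs : s ⊆ slitPlane) :
    IsHypergeometricSolution a b c s (fun z => z ^ (-c) * (z * g z))
      (fun z => z ^ (-c) * ((1 - c) * g z + z * g' z))
      (fun z => z ^ (-c) * (-(c * (1 - c)) * g z / z + 2 * (1 - c) * g' z + z * g'' z)) := by
  refine ⟨fun z hz => ?_, fun z hz => ?_, fun z hz => ?_⟩ <;>
    have hz0 : z ≠ 0 := slitPlane_ne_zero (hs hz)
  · refine ((hasDerivAt_cpow_const_slitPlane (hs hz) (-c)).fun_mul
      ((hasDerivAt_id' z).fun_mul (h.hasDerivAt z hz))).congr_deriv ?_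
    field_simp
    ring
  · refine ((hasDerivAt_cpow_const_slitPlane (hs hz) (-c)).fun_mul
      (((h.hasDerivAt z hz).const_mul (1 - c)).fun_add
        ((hasDerivAt_id' z).fun_mul (h.hasDerivAt' z hz)))).congr_deriv ?_
    field_simp
    ring
  · have := h.eq_zero z hz
    field_simp
    linear_combination z * z ^ (-c) * this

/-- Abel's identity. -/
lemma IsHypergeometricSolution.exists_wronskian_eq {a b c : ℂ} {s : Set ℂ}
    {y₁ y₁' y₁'' y₂ y₂' y₂'' : ℂ → ℂ} (h₁ : IsHypergeometricSolution a b c s y₁ y₁' y₁'')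
    (h₂ : IsHypergeometricSolution a b c s y₂ y₂' y₂'') (hs : s ⊆ slitPlane)
    (hs1 : s ⊆ slitAtOne) (hso : IsOpen s) (hsc : IsPreconnected s) :
    ∃ k : ℂ, ∀ z ∈ s, z ^ c * (1 - z) ^ (a + b + 1 - c) * (y₁ z * y₂' z - y₂ z * y₁' z) = k := by
  have hd : ∀ z ∈ s, HasDerivAt (fun z => z ^ c * (1 - z) ^ (a + b + 1 - c) *
      (y₁ z * y₂' z - y₂ z * y₁' z)) 0 z := by
    intro z hz
    have hz0 : z ≠ 0 := slitPlane_ne_zero (hs hz)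
    have hz1 : 1 - z ≠ 0 := slitPlane_ne_zero (hs1 hz)
    have hsub : HasDerivAt (fun z : ℂ => 1 - z) (-1) z := by
      simpa using (hasDerivAt_id z).const_sub 1
    have hP := hasDerivAt_cpow_const_slitPlane (hs hz) c
    have hR := (hasDerivAt_cpow_const_slitPlane (hs1 hz) (a + b + 1 - c)).comp z hsub
    have hW := ((h₁.hasDerivAt z hz).fun_mul (h₂.hasDerivAt' z hz)).fun_sub
      ((h₂.hasDerivAt z hz).fun_mul (h₁.hasDerivAt' z hz))
    refine ((hP.fun_mul hR).fun_mul hW).congr_deriv ?_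
    have e1 := h₁.eq_zero z hz
    have e2 := h₂.eq_zero z hz
    simp only [Function.comp_def]
    field_simp
    -- In $y_1e_2-y_2e_1$ the undifferentiated terms cancel, which leaves a first-order equation for
    -- the Wronskian. The prefactor is its integrating factor.
    linear_combination z ^ c * (1 - z) ^ (a + b + 1 - c) * (y₁ z * e2 - y₂ z * e1)
  exact hso.exists_is_const_of_deriv_eq_zero hsc
    (fun z hz => (hd z hz).differentiableAt.differentiableWithinAt) fun z hz => (hd z hz).deriv

/-! ### The connection formula between 0 and 1 -/

lemma ball_half_subset_slitPlane : Metric.ball (1 / 2 : ℂ) (1 / 2) ⊆ slitPlane := by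
  intro z hz
  rw [mem_ball_iff_norm] at hz
  have := (abs_le.1 (abs_re_le_norm (z - 1 / 2))).1
  refine Or.inl ?_
  simp only [sub_re] at this
  norm_num at this
  linarith

lemma one_sub_mem_ball_half {z : ℂ} (hz : z ∈ Metric.ball (1 / 2 : ℂ) (1 / 2)) :
    1 - z ∈ Metric.ball (1 / 2 : ℂ) (1 / 2) := by
  rw [mem_ball_iff_norm] at hz ⊢
  rwa [← norm_neg, show -(1 - z - 1 / 2) = z - 1 / 2 by ring]

lemma ball_half_subset_slitAtOne : Metric.ball (1 / 2 : ℂ) (1 / 2) ⊆ slitAtOne :=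
  fun _ hz => ball_half_subset_slitPlane (one_sub_mem_ball_half hz)

lemma ball_half_subset_ball : Metric.ball (1 / 2 : ℂ) (1 / 2) ⊆ Metric.ball 0 1 :=
  Metric.ball_subset_ball' (by norm_num)

lemma ofReal_mem_ball_half {x : ℝ} (hx : x ∈ Set.Ioo (0 : ℝ) 1) :
    (x : ℂ) ∈ Metric.ball (1 / 2 : ℂ) (1 / 2) := by
  rw [mem_ball_iff_norm, show (x : ℂ) - 1 / 2 = ((x - 1 / 2 : ℝ) : ℂ) by push_cast; ring, norm_real,
    Real.norm_eq_abs, abs_lt]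
  constructor <;> linarith [hx.1, hx.2]

/-- Any solution on the disc over `(0, 1)` is a combination of the two Frobenius solutions
at `0`. -/
lemma IsHypergeometricSolution.exists_eq_add {a b c : ℂ} {u u' u'' g g' g'' y y' y'' : ℂ → ℂ}
    (hc : c ≠ 1) (hu : IsHypergeometricSolution a b c (Metric.ball 0 1) u u' u'')
    (hg : IsHypergeometricSolution (a - c + 1) (b - c + 1) (2 - c) (Metric.ball 0 1) g g' g'')
    (hu0 : u 0 ≠ 0) (hg0 : g 0 ≠ 0)
    (hy : IsHypergeometricSolution a b c (Metric.ball (1 / 2) (1 / 2)) y y' y'') :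
    ∃ C D : ℂ, ∀ z ∈ Metric.ball (1 / 2 : ℂ) (1 / 2),
      y z = C * u z + D * (z ^ (-c) * (z * g z)) := by
  have hu1 := hu.mono ball_half_subset_ball
  have hw := (hg.mono ball_half_subset_ball).cpow_mul ball_half_subset_slitPlane
  have hc1 := (convex_ball (1 / 2 : ℂ) (1 / 2)).isPreconnected
  obtain ⟨k, hk⟩ := hu1.exists_wronskian_eq hw ball_half_subset_slitPlane
    ball_half_subset_slitAtOne Metric.isOpen_ball hc1
  obtain ⟨k₁, hk₁⟩ := hy.exists_wronskian_eq hw ball_half_subset_slitPlane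
    ball_half_subset_slitAtOne Metric.isOpen_ball hc1
  obtain ⟨k₂, hk₂⟩ := hy.exists_wronskian_eq hu1 ball_half_subset_slitPlane
    ball_half_subset_slitAtOne Metric.isOpen_ball hc1
  -- In the weighted Wronskian of the two Frobenius solutions the factor $z^c$ cancels $z^{-c}$.
  -- What remains is continuous at $0$, with value $(1-c)u(0)g(0)\ne0$.
  have hk0 : k ≠ 0 := by
    have h0 : (0 : ℂ) ∈ Metric.ball (0 : ℂ) 1 := by simp
    have hcont : ContinuousAt (fun z : ℂ => (1 - z) ^ (a + b + 1 - c) *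
        (u z * ((1 - c) * g z + z * g' z) - z * g z * u' z)) 0 := by
      have c1 := (hu.hasDerivAt 0 h0).continuousAt
      have c2 := (hu.hasDerivAt' 0 h0).continuousAt
      have c3 := (hg.hasDerivAt 0 h0).continuousAt
      have c4 := (hg.hasDerivAt' 0 h0).continuousAt
      have c5 : ContinuousAt (fun z : ℂ => (1 - z) ^ (a + b + 1 - c)) 0 :=
        ContinuousAt.cpow (by fun_prop) continuousAt_const (by simp)
      fun_prop
    have hlim : Tendsto (fun x : ℝ => (x : ℂ)) (𝓝[>] 0) (𝓝 0) := by
      have : Continuous fun x : ℝ => (x : ℂ) := continuous_ofReal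
      simpa using (this.tendsto 0).mono_left nhdsWithin_le_nhds
    have h1 := hcont.tendsto.comp hlim
    have h2 : ∀ᶠ x : ℝ in 𝓝[>] 0, (1 - (x : ℂ)) ^ (a + b + 1 - c) *
        (u x * ((1 - c) * g x + x * g' x) - x * g x * u' x) = k := by
      filter_upwards [Ioo_mem_nhdsGT (one_pos : (0 : ℝ) < 1)] with x hx
      have hxs := ofReal_mem_ball_half hx
      have hx0 := slitPlane_ne_zero (ball_half_subset_slitPlane hxs)
      rw [← hk x hxs, cpow_neg]
      have : (x : ℂ) ^ c ≠ 0 := by simp [cpow_eq_zero_iff, hx0]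
      field_simp
    have h3 := tendsto_nhds_unique h1 (tendsto_const_nhds.congr' (h2.mono fun _ h => h.symm))
    rw [← h3]
    simp [hu0, hg0, sub_ne_zero.2 hc.symm]
  -- Cramer's rule: the coefficients are quotients of constant Wronskians, and
  -- $y\,W(u,w)=u\,W(y,w)-w\,W(y,u)$ holds identically.
  refine ⟨k₁ / k, -k₂ / k, fun z hz => ?_⟩
  have e := hk z hz
  have e1 := hk₁ z hz
  have e2 := hk₂ z hz
  field_simp
  rw [← e, ← e1, ← e2]
  ring

/-- Gauss's evaluation at `1`, as a limit. -/
lemma tendsto_ordinaryHypergeometric_one {a b c : ℝ} (ha : 0 ≤ a) (hb : 0 < b) (hcb : 0 < c - b)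
    (hcab : 0 < c - a - b) :
    Tendsto (fun x : ℝ => ordinaryHypergeometric (a : ℂ) (b : ℂ) (c : ℂ) (x : ℂ)) (𝓝[<] 1)
      (𝓝 ((Real.Gamma c * Real.Gamma (c - a - b) / (Real.Gamma (c - a) * Real.Gamma (c - b)) : ℝ)
        : ℂ)) := by
  refine (tendsto_eulerIntegral_one ha hb hcb hcab).congr' ?_
  filter_upwards [Ioo_mem_nhdsLT (one_pos : (0 : ℝ) < 1)] with x hx
  exact eulerIntegral_eq_ordinaryHypergeometric hb hcb
    (by rw [norm_real, Real.norm_of_nonneg hx.1.le]; exact hx.2)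

lemma sin_mul_sin_sub_sin_mul_sin (x y z : ℝ) :
    Real.sin (z - x) * Real.sin (z - y) - Real.sin x * Real.sin y
      = Real.sin z * Real.sin (z - (x + y)) := by
  rw [Real.sin_sub z (x + y), Real.sin_sub, Real.sin_sub, Real.sin_add, Real.cos_add]
  linear_combination (Real.sin x * Real.sin y) * Real.sin_sq_add_cos_sq z

/-- This is the connection formula evaluated at $z=1$. The reflection formula turns the two products
into $\sin\pi(c-a)\sin\pi(c-b)$ and $\sin\pi a\sin\pi b$, both over $\sin\pi c\,\sin\pi(c-a-b)$.
Their difference is $1$ by `sin_mul_sin_sub_sin_mul_sin`. -/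
lemma gauss_sum_relation {a b c : ℝ} (ha : 0 < a) (hb : 0 < b) (hc1 : c < 1) (habc : a + b < c) :
    -1 / K₂ a b c * (Real.Gamma c * Real.Gamma (c - a - b) /
        (Real.Gamma (c - a) * Real.Gamma (c - b)))
      - gammaQuot a b c / (1 - c) * (Real.Gamma (2 - c) * Real.Gamma (c - a - b) /
        (Real.Gamma (1 - a) * Real.Gamma (1 - b))) = 1 := by
  have g : ∀ {x : ℝ}, 0 < x → 0 < Real.Gamma x := fun h => Real.Gamma_pos_of_pos h
  have s : ∀ {x : ℝ}, 0 < x → x < 1 → 0 < Real.sin (Real.pi * x) := fun h h1 =>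
    Real.sin_pos_of_pos_of_lt_pi (by positivity) (by nlinarith [Real.pi_pos])
  have hpi := Real.pi_pos
  have e2 : Real.Gamma (2 - c) = (1 - c) * Real.Gamma (1 - c) := by
    rw [show 2 - c = (1 - c) + 1 by ring, Real.Gamma_add_one (by linarith)]
  have ra := Real.Gamma_mul_Gamma_one_sub a
  have rb := Real.Gamma_mul_Gamma_one_sub b
  have rc := Real.Gamma_mul_Gamma_one_sub c
  have rca := Real.Gamma_mul_Gamma_one_sub (c - a)
  have rcb := Real.Gamma_mul_Gamma_one_sub (c - b)
  have rd := Real.Gamma_mul_Gamma_one_sub (c - a - b)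
  rw [show 1 - (c - a) = a + 1 - c by ring] at rca
  rw [show 1 - (c - b) = b + 1 - c by ring] at rcb
  rw [show 1 - (c - a - b) = a + b + 1 - c by ring] at rd
  have hsin := sin_mul_sin_sub_sin_mul_sin (Real.pi * a) (Real.pi * b) (Real.pi * c)
  rw [← mul_sub, ← mul_sub, ← mul_add, ← mul_sub, ← sub_sub] at hsin
  have p1 := s ha (by linarith)
  have p2 := s hb (by linarith)
  have p3 := s (show 0 < c by linarith) hc1
  have p4 := s (show 0 < c - a by linarith) (by linarith)
  have p5 := s (show 0 < c - b by linarith) (by linarith)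
  have p6 := s (show 0 < c - a - b by linarith) (by linarith)
  have q1 := g ha
  have q2 := g hb
  have q3 := g (show 0 < c by linarith)
  have q4 := g (show 0 < c - a by linarith)
  have q5 := g (show 0 < c - b by linarith)
  have q6 := g (show 0 < c - a - b by linarith)
  have r1 := g (show 0 < 1 - a by linarith)
  have r2 := g (show 0 < 1 - b by linarith)
  have r3 := g (show 0 < 1 - c by linarith)
  have r4 := g (show 0 < a + 1 - c by linarith)
  have r5 := g (show 0 < b + 1 - c by linarith)
  have r6 := g (show 0 < a + b + 1 - c by linarith)
  have h1c : 1 - c ≠ 0 := by linarith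
  have t1 : -1 / K₂ a b c * (Real.Gamma c * Real.Gamma (c - a - b) /
        (Real.Gamma (c - a) * Real.Gamma (c - b)))
      = (Real.Gamma c * Real.Gamma (1 - c)) *
          (Real.Gamma (c - a - b) * Real.Gamma (a + b + 1 - c)) /
        ((Real.Gamma (c - a) * Real.Gamma (a + 1 - c)) *
          (Real.Gamma (c - b) * Real.Gamma (b + 1 - c))) := by
    rw [K₂]
    field_simp
  have t2 : gammaQuot a b c / (1 - c) * (Real.Gamma (2 - c) * Real.Gamma (c - a - b) /
        (Real.Gamma (1 - a) * Real.Gamma (1 - b)))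
      = (Real.Gamma c * Real.Gamma (1 - c)) *
          (Real.Gamma (c - a - b) * Real.Gamma (a + b + 1 - c)) /
        ((Real.Gamma a * Real.Gamma (1 - a)) * (Real.Gamma b * Real.Gamma (1 - b))) := by
    rw [gammaQuot, e2, show a + b - c + 1 = a + b + 1 - c by ring]
    field_simp
  rw [t1, t2, ra, rb, rc, rca, rcb, rd]
  field_simp
  exact hsin

/-- The solution `F(a - c + 1, b - c + 1, 2 - c; z)`, which goes with the exponent `1 - c`. -/
noncomputable def φ₃ (a b c : ℝ) (z : ℂ) : ℂ :=
  ordinaryHypergeometric ((a - c + 1 : ℝ) : ℂ) ((b - c + 1 : ℝ) : ℂ) ((2 - c : ℝ) : ℂ) z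

lemma φ₁_eq_ordinaryHypergeometric {a b c : ℝ} (hb : 0 < b) (hcb : 0 < c - b) :
    Set.EqOn (φ₁ a b c) (ordinaryHypergeometric (a : ℂ) (b : ℂ) (c : ℂ)) (Metric.ball 0 1) :=
  (isHypergeometricContinuation_F hb hcb).2

lemma isHypergeometricContinuation_φ₂ {a b c : ℝ} (hb : 0 < b) (hac : 0 < a - c + 1) :
    IsHypergeometricContinuation (a : ℂ) (b : ℂ) ((a + b - c + 1 : ℝ) : ℂ)
      (F a b (a + b - c + 1)) := by
  have := isHypergeometricContinuation_F (a := a) (b := b) (c := a + b - c + 1) hb (by linarith)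
  push_cast at this ⊢
  exact this

lemma one_sub_mem_slitAtOne {z : ℂ} (hz : z ∈ slitPlane) : 1 - z ∈ slitAtOne := by
  simpa [slitAtOne] using hz

/-- The connection formula between `0` and `1`, over the disc with diameter `[0, 1]`. -/
lemma connection_formula_ball_half {a b c : ℝ} (ha : 0 < a) (hb : 0 < b) (hc1 : c < 1)
    (habc : a + b < c) {z : ℂ} (hz : z ∈ Metric.ball (1 / 2 : ℂ) (1 / 2)) :
    φ₂ a b c z = ((-1 / K₂ a b c : ℝ) : ℂ) * φ₁ a b c z
      + ((-(gammaQuot a b c / (1 - c)) : ℝ) : ℂ) * (z ^ (-(c : ℂ)) * (z * φ₃ a b c z)) := by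
  have hc0 : 0 < c := by linarith
  have ecy : (a : ℂ) + b - c + 1 = ((a + b - c + 1 : ℝ) : ℂ) := by push_cast; ring
  have hu := isHypergeometricSolution_ordinaryHypergeometric ha hb hc0
  have hg : IsHypergeometricSolution ((a : ℂ) - c + 1) ((b : ℂ) - c + 1) (2 - (c : ℂ))
      (Metric.ball 0 1) (φ₃ a b c) (deriv (φ₃ a b c)) (deriv (deriv (φ₃ a b c))) := by
    rw [show (a : ℂ) - c + 1 = ((a - c + 1 : ℝ) : ℂ) by push_cast; ring,
      show (b : ℂ) - c + 1 = ((b - c + 1 : ℝ) : ℂ) by push_cast; ring,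
      show 2 - (c : ℂ) = ((2 - c : ℝ) : ℂ) by push_cast; ring]
    exact isHypergeometricSolution_ordinaryHypergeometric (by linarith) (by linarith)
      (by linarith)
  have hy₀ := isHypergeometricSolution_ordinaryHypergeometric (a := a) (b := b)
    (c := a + b - c + 1) ha hb (by linarith)
  have hy : IsHypergeometricSolution (a : ℂ) (b : ℂ) (c : ℂ) ((fun z => 1 - z) ⁻¹' _) _ _ _ :=
    IsHypergeometricSolution.comp_one_sub (by rw [ecy]; exact hy₀)
  have hg0 : φ₃ a b c 0 = 1 := by simp [φ₃]
  obtain ⟨C, D, hCD⟩ := IsHypergeometricSolution.exists_eq_add (by exact_mod_cast hc1.ne) hu hg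
    (by simp) (by simp [hg0]) (hy.mono
      fun z hz => ball_half_subset_ball (one_sub_mem_ball_half hz))
  have hcu : ContinuousAt _ _ := (hu.hasDerivAt 0 (by simp)).continuousAt
  have hcg : ContinuousAt _ _ := (hg.hasDerivAt 0 (by simp)).continuousAt
  have hcy : ContinuousAt _ _ := (hy₀.hasDerivAt 0 (by simp)).continuousAt
  have hof : Continuous fun x : ℝ => (x : ℂ) := continuous_ofReal
  have hsub : Continuous fun x : ℝ => 1 - x := continuous_const.sub continuous_id
  -- Let $x\to0^+$: since $c<1$ the term with $x^{1-c}$ vanishes, so $C$ is Gauss's value of the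
  -- series for $\varphi_2$ at argument $1$.
  have hCval : C = ((-1 / K₂ a b c : ℝ) : ℂ) := by
    have hsub0 : Tendsto (fun x : ℝ => 1 - x) (𝓝[>] 0) (𝓝[<] 1) := by
      refine tendsto_nhdsWithin_iff.2 ⟨?_, ?_⟩
      · simpa using (hsub.tendsto 0).mono_left nhdsWithin_le_nhds
      · filter_upwards [self_mem_nhdsWithin] with x hx
        simpa using hx
    have hid : Tendsto (fun x : ℝ => (x : ℂ)) (𝓝[>] 0) (𝓝 0) := by
      simpa using (hof.tendsto 0).mono_left nhdsWithin_le_nhds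
    have hl := (tendsto_ordinaryHypergeometric_one (a := a) (b := b) (c := a + b - c + 1) ha.le hb
      (by linarith) (by linarith)).comp hsub0
    have hpow : Tendsto (fun x : ℝ => ((x ^ (1 - c) : ℝ) : ℂ)) (𝓝[>] 0) (𝓝 0) := by
      have h1 : ContinuousAt (fun x : ℝ => x ^ (1 - c)) 0 :=
        Real.continuousAt_rpow_const _ _ (Or.inr (by linarith))
      have h2 := (hof.tendsto _).comp (h1.tendsto.mono_left (nhdsWithin_le_nhds (s := Set.Ioi 0)))
      simpa [Function.comp_def, Real.zero_rpow (show 1 - c ≠ 0 by linarith)] using h2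
    have hr := ((hcu.tendsto.comp hid).const_mul C).add
      ((hpow.mul (hcg.tendsto.comp hid)).const_mul D)
    have huniq := tendsto_nhds_unique (hl.congr' ?_) hr
    · simp only [ordinaryHypergeometric_zero, zero_mul, mul_zero, mul_one, add_zero] at huniq
      rw [← huniq, K₂]
      congr 1
      rw [show a + b - c + 1 - a - b = 1 - c by ring, show a + b - c + 1 - a = b + 1 - c by ring,
        show a + b - c + 1 - b = a + 1 - c by ring, show a + b - c + 1 = a + b + 1 - c by ring,
        neg_div_neg_eq, one_div_div]
      ring
    · filter_upwards [Ioo_mem_nhdsGT (one_pos : (0 : ℝ) < 1)] with x hx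
      have h := hCD x (ofReal_mem_ball_half hx)
      have h3 : ((x ^ (1 - c) : ℝ) : ℂ) = (x : ℂ) ^ (-(c : ℂ)) * x := by
        rw [sub_eq_add_neg, add_comm, Real.rpow_add hx.1, Real.rpow_one, ofReal_mul,
          ofReal_cpow hx.1.le, ofReal_neg]
      simp only [Function.comp_apply, h3]
      push_cast at h ⊢
      rw [h]
      ring
  -- Let $x\to1^-$: the left side tends to $1$, and both Frobenius solutions tend to Gauss values.
  -- As $C$ is known and the value for `φ₃` is nonzero, `gauss_sum_relation` determines $D$.
  have hDval : D = ((-(gammaQuot a b c / (1 - c)) : ℝ) : ℂ) := by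
    have hsub1 : Tendsto (fun x : ℝ => ((1 - x : ℝ) : ℂ)) (𝓝[<] 1) (𝓝 0) := by
      simpa [Function.comp_def] using (((hof.comp hsub).tendsto 1).mono_left (nhdsWithin_le_nhds (s := Set.Iio 1)))
    have hid : Tendsto (fun x : ℝ => (x : ℂ)) (𝓝[<] 1) (𝓝 1) := by
      simpa using (hof.tendsto 1).mono_left nhdsWithin_le_nhds
    have hpow : Tendsto (fun x : ℝ => (x : ℂ) ^ (-(c : ℂ))) (𝓝[<] 1) (𝓝 1) := by
      have h1 : ContinuousAt (fun z : ℂ => z ^ (-(c : ℂ))) 1 :=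
        ContinuousAt.cpow continuousAt_id continuousAt_const (by simp)
      simpa [Function.comp_def] using h1.tendsto.comp hid
    have hl := hcy.tendsto.comp hsub1
    have hgauss := tendsto_ordinaryHypergeometric_one (a := a) (b := b) (c := c) ha.le hb
      (by linarith) (by linarith)
    have hgauss3 := tendsto_ordinaryHypergeometric_one (a := a - c + 1) (b := b - c + 1)
      (c := 2 - c) (by linarith) (by linarith) (by linarith) (by linarith)
    have hr := (hgauss.const_mul C).add ((hpow.mul (hid.mul hgauss3)).const_mul D)
    have huniq := tendsto_nhds_unique (hl.congr' ?_) hr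
    · have hrel := gauss_sum_relation ha hb hc1 habc
      rw [show 2 - c - (a - c + 1) - (b - c + 1) = c - a - b by ring,
        show 2 - c - (a - c + 1) = 1 - a by ring, show 2 - c - (b - c + 1) = 1 - b by ring,
        hCval, ordinaryHypergeometric_zero, one_mul, one_mul] at huniq
      have hpos : Real.Gamma (2 - c) * Real.Gamma (c - a - b) /
          (Real.Gamma (1 - a) * Real.Gamma (1 - b)) ≠ 0 := by
        refine (div_pos (mul_pos ?_ ?_) (mul_pos ?_ ?_)).ne' <;>
          exact Real.Gamma_pos_of_pos (by linarith)
      refine mul_right_cancel₀ (ofReal_ne_zero.2 hpos) ?_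
      have hrel' := congrArg (fun r : ℝ => (r : ℂ)) hrel
      simp only [ofReal_sub, ofReal_mul (-1 / K₂ a b c),
        ofReal_mul (gammaQuot a b c / (1 - c)), ofReal_one] at hrel'
      rw [ofReal_neg]
      linear_combination -hrel' - huniq
    · filter_upwards [Ioo_mem_nhdsLT (one_pos : (0 : ℝ) < 1)] with x hx
      have h := hCD x (ofReal_mem_ball_half hx)
      simp only [Function.comp_apply]
      rw [ofReal_sub, ofReal_one]
      exact h
  have h := hCD z hz
  rw [φ₁_eq_ordinaryHypergeometric hb (by linarith) (ball_half_subset_ball hz), ← hCval, ← hDval,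
    ← h, φ₂]
  rw [(isHypergeometricContinuation_φ₂ hb (by linarith)).2
    (ball_half_subset_ball (one_sub_mem_ball_half hz))]

/-- The intersection of the unit disc with the slit plane is star-shaped about $1/2$, so the
identity theorem extends the formula from the smaller disc. -/
lemma connection_formula {a b c : ℝ} (ha : 0 < a) (hb : 0 < b) (hc1 : c < 1)
    (habc : a + b < c) {z : ℂ} (hz : ‖z‖ < 1) (hz' : z ∈ slitPlane) :
    φ₂ a b c z = ((-1 / K₂ a b c : ℝ) : ℂ) * φ₁ a b c z
      + ((-(gammaQuot a b c / (1 - c)) : ℝ) : ℂ) * (z ^ (-(c : ℂ)) * (z * φ₃ a b c z)) := by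
  have hball : (1 / 2 : ℂ) ∈ Metric.ball (1 / 2 : ℂ) (1 / 2) := by simp
  have hcb : 0 < c - b := by linarith
  have hstar : StarConvex ℝ (1 / 2 : ℂ) (Metric.ball (0 : ℂ) 1 ∩ slitPlane) := by
    refine ((convex_ball (0 : ℂ) 1).starConvex (ball_half_subset_ball hball)).inter ?_
    have := starConvex_ofReal_slitPlane (x := 1 / 2) (by norm_num)
    push_cast at this
    exact this
  have hpre : IsPreconnected (Metric.ball (0 : ℂ) 1 ∩ slitPlane) :=
    (hstar.isPathConnected ⟨ball_half_subset_ball hball,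
      ball_half_subset_slitPlane hball⟩).isConnected.isPreconnected
  have hφ₂ : AnalyticOnNhd ℂ (φ₂ a b c) (Metric.ball (0 : ℂ) 1 ∩ slitPlane) := by
    have h := (isHypergeometricContinuation_φ₂ (a := a) (b := b) (c := c) hb (by linarith)).1
    exact fun z hz => (h (1 - z) (one_sub_mem_slitAtOne hz.2)).comp (f := fun z => 1 - z)
      (analyticAt_const.sub analyticAt_id)
  have hφ₁ : AnalyticOnNhd ℂ (φ₁ a b c) (Metric.ball (0 : ℂ) 1 ∩ slitPlane) := fun z hz =>
    (isHypergeometricContinuation_F hb hcb).1 z (ball_subset_slitAtOne hz.1)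
  have hφ₃ : AnalyticOnNhd ℂ (φ₃ a b c) (Metric.ball (0 : ℂ) 1 ∩ slitPlane) := fun z hz =>
    analyticOnNhd_ordinaryHypergeometric (by linarith) (by linarith) (by linarith) z hz.1
  have hpow : AnalyticOnNhd ℂ (fun z : ℂ => z ^ (-(c : ℂ))) (Metric.ball (0 : ℂ) 1 ∩ slitPlane) :=
    fun z hz => analyticAt_id.cpow analyticAt_const hz.2
  exact hφ₂.eqOn_of_preconnected_of_eventuallyEq
    (g := fun z => ((-1 / K₂ a b c : ℝ) : ℂ) * φ₁ a b c z
      + ((-(gammaQuot a b c / (1 - c)) : ℝ) : ℂ) * (z ^ (-(c : ℂ)) * (z * φ₃ a b c z)))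
    ((analyticOnNhd_const.mul hφ₁).add
      (analyticOnNhd_const.mul (hpow.mul (analyticOnNhd_id.mul hφ₃)))) hpre
    (z₀ := 1 / 2) ⟨ball_half_subset_ball hball, ball_half_subset_slitPlane hball⟩
    (by
      filter_upwards [Metric.isOpen_ball.mem_nhds hball] with w hw
      exact connection_formula_ball_half ha hb hc1 habc hw)
    ⟨by simpa using hz, hz'⟩

/-! ### The denominator near the puncture -/

lemma φ₂_conj {a b c : ℝ} (hb : 0 < b) (hac : 0 < a - c + 1) {z : ℂ} (hz : z ∈ slitPlane) :
    φ₂ a b c (conj z) = conj (φ₂ a b c z) := by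
  have h := F_conj (a := a) (b := b) (c := a + b - c + 1) hb (by linarith) (one_sub_mem_slitAtOne hz)
  push_cast at h
  simpa [φ₂] using h

lemma dense_doublySlit : Dense doublySlit := by
  refine ((dense_compl_singleton (0 : ℝ)).preimage isOpenMap_im).mono fun z hz => ?_
  have hz' : z.im ≠ 0 := hz
  exact ⟨Or.inr hz', Or.inr (by simpa using hz')⟩

lemma conj_mem_slitPlane {z : ℂ} (hz : z ∈ slitPlane) : conj z ∈ slitPlane := by
  simpa [mem_slitPlane_iff] using hz

lemma continuousOn_φ₁ {a b c : ℝ} (hb : 0 < b) (hcb : 0 < c - b) :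
    ContinuousOn (φ₁ a b c) slitAtOne :=
  (isHypergeometricContinuation_F hb hcb).1.continuousOn

lemma continuousOn_φ₂ {a b c : ℝ} (hb : 0 < b) (hac : 0 < a - c + 1) :
    ContinuousOn (φ₂ a b c) slitPlane :=
  (isHypergeometricContinuation_φ₂ hb hac).1.continuousOn.comp
    (continuous_const.sub continuous_id).continuousOn fun _ hz => one_sub_mem_slitAtOne hz

lemma continuousOn_denomFormula {a b c : ℝ} (hb : 0 < b) (hcb : 0 < c - b)
    (hac : 0 < a - c + 1) : ContinuousOn (denomFormula a b c) doublySlit := by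
  have h1 := (continuousOn_φ₁ (a := a) hb hcb).mono (Set.inter_subset_right (s := slitPlane))
  have h2 := (continuousOn_φ₂ hb hac).mono (Set.inter_subset_left (t := slitAtOne))
  have h3 : ContinuousOn (fun z => φ₂ a b c (conj z)) doublySlit :=
    (continuousOn_φ₂ hb hac).comp continuous_conj.continuousOn
      fun z hz => conj_mem_slitPlane hz.1
  exact ((continuousOn_const.mul (h1.norm.pow 2)).add (continuousOn_const.mul (h2.norm.pow 2))).add
    (continuousOn_const.mul (continuous_re.comp_continuousOn (h1.mul h3)))

lemma M_eq_denomFormula {a b c : ℝ} (hb : 0 < b) (hcb : 0 < c - b) (hac : 0 < a - c + 1) {z : ℂ}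
    (hz : z ∈ doublySlit) : M a b c z = denomFormula a b c z :=
  extendFrom_eq (subset_closure hz) (continuousOn_denomFormula hb hcb hac z hz)

lemma M_eq_add {a b c : ℝ} (hb : 0 < b) (hcb : 0 < c - b) (hac : 0 < a - c + 1) {z : ℂ}
    (hz : z ∈ doublySlit) :
    (M a b c z : ℂ) = (K₁ a b c * φ₁ a b c (conj z) + φ₂ a b c (conj z)) * φ₁ a b c z
      + (K₂ a b c * φ₂ a b c (conj z) + φ₁ a b c (conj z)) * φ₂ a b c z := by
  have h1 : φ₁ a b c (conj z) = conj (φ₁ a b c z) := F_conj hb hcb hz.2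
  have h2 := φ₂_conj hb hac hz.1
  rw [M_eq_denomFormula hb hcb hac hz, denomFormula, h1, h2]
  generalize φ₁ a b c z = u
  generalize φ₂ a b c z = v
  have e : ((2 * (u * conj v).re : ℝ) : ℂ) = u * conj v + conj u * v := by
    have := add_conj (u * conj v)
    rw [map_mul, conj_conj] at this
    exact_mod_cast this.symm
  rw [ofReal_add, e]
  push_cast
  rw [← mul_conj', ← mul_conj']
  ring

/-- The denominator `M` in terms of the Frobenius solutions at `0`, which are unramified up to the
factor `|z| ^ (1 - c)`. -/
noncomputable def localFormula (a b c : ℝ) (z : ℂ) : ℝ :=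
  (K₁ a b c - 1 / K₂ a b c) * ‖φ₁ a b c z‖ ^ 2
    + K₂ a b c * (gammaQuot a b c / (1 - c)) ^ 2 * (‖z‖ ^ (2 * (1 - c)) * ‖φ₃ a b c z‖ ^ 2)

lemma K₂_ne_zero {a b c : ℝ} (ha : 0 < a) (hb : 0 < b) (hc1 : c < 1) :
    K₂ a b c ≠ 0 := by
  refine neg_ne_zero.2 (div_pos (mul_pos ?_ ?_) (mul_pos ?_ ?_)).ne' <;>
    exact Real.Gamma_pos_of_pos (by linarith)

/-- Write $\varphi_2=Au+Dw$ with $u=\varphi_1$, $w=z^{1-c}\varphi_3$ and $A=-1/K_2$. The cross term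
is $2D(K_2A+1)\,\mathrm{Re}(u\bar w)=0$, and $|u|^2$ gets $K_1+K_2A^2+2A=K_1-1/K_2$. -/
lemma denomFormula_eq_localFormula {a b c : ℝ} (ha : 0 < a) (hb : 0 < b) (hc1 : c < 1)
    (habc : a + b < c) {z : ℂ} (hz : ‖z‖ < 1) (hz' : z ∈ slitPlane) :
    denomFormula a b c z = localFormula a b c z := by
  have hK := K₂_ne_zero ha hb hc1
  have hw : ‖z ^ (-(c : ℂ)) * (z * φ₃ a b c z)‖ ^ 2
      = ‖z‖ ^ (2 * (1 - c)) * ‖φ₃ a b c z‖ ^ 2 := by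
    have hpos : 0 < ‖z‖ := norm_pos_iff.2 (slitPlane_ne_zero hz')
    rw [norm_mul, norm_mul, ← ofReal_neg, norm_cpow_real, ← mul_assoc, mul_pow]
    congr 1
    rw [mul_comm 2, Real.rpow_mul hpos.le, Real.rpow_two, sub_eq_add_neg, Real.rpow_add hpos,
      Real.rpow_one, mul_comm]
  rw [denomFormula, localFormula, φ₂_conj hb (by linarith) hz', ← hw,
    connection_formula ha hb hc1 habc hz hz']
  generalize φ₁ a b c z = u
  generalize z ^ (-(c : ℂ)) * (z * φ₃ a b c z) = w
  generalize gammaQuot a b c / (1 - c) = G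
  simp only [← normSq_eq_norm_sq, normSq_apply, map_add, map_mul, conj_ofReal, add_re, add_im,
    mul_re, mul_im, ofReal_re, ofReal_im, conj_re, conj_im]
  field_simp
  ring

lemma φ₃_analyticOnNhd {a b c : ℝ} (ha : 0 < a) (hb : 0 < b) (hc1 : c < 1) :
    AnalyticOnNhd ℂ (φ₃ a b c) (Metric.ball 0 1) :=
  analyticOnNhd_ordinaryHypergeometric (by linarith) (by linarith) (by linarith)

lemma φ₁_analyticOnNhd {a b c : ℝ} (hb : 0 < b) (hcb : 0 < c - b) :
    AnalyticOnNhd ℂ (φ₁ a b c) (Metric.ball 0 1) :=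
  fun z hz => (isHypergeometricContinuation_F hb hcb).1 z (ball_subset_slitAtOne hz)

lemma contDiffOn_localFormula {a b c : ℝ} (ha : 0 < a) (hb : 0 < b) (hc1 : c < 1)
    (habc : a + b < c) : ContDiffOn ℝ ∞ (localFormula a b c) (Metric.ball 0 1 \ {0}) := by
  have h1 : ContDiffOn ℝ ∞ (φ₁ a b c) (Metric.ball 0 1 \ {0}) := fun z hz =>
    ((φ₁_analyticOnNhd hb (by linarith) z hz.1).restrictScalars
      (𝕜 := ℝ)).contDiffAt.contDiffWithinAt
  have h3 : ContDiffOn ℝ ∞ (φ₃ a b c) (Metric.ball 0 1 \ {0}) := fun z hz =>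
    ((φ₃_analyticOnNhd ha hb hc1 z hz.1).restrictScalars (𝕜 := ℝ)).contDiffAt.contDiffWithinAt
  have hn : ContDiffOn ℝ ∞ (fun z : ℂ => ‖z‖ ^ (2 * (1 - c))) (Metric.ball 0 1 \ {0}) :=
    fun z hz => ((contDiffAt_norm ℝ hz.2).rpow_const_of_ne
      (norm_ne_zero_iff.2 hz.2)).contDiffWithinAt
  exact (contDiffOn_const.mul (h1.norm_sq ℝ)).add
    (contDiffOn_const.mul (hn.mul (h3.norm_sq ℝ)))

/-- The local formula is continuous across the cut $(-1,0)$ and agrees with the defining formula on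
a dense set, so it is the continuous extension. -/
lemma M_eq_localFormula {a b c : ℝ} (ha : 0 < a) (hb : 0 < b) (hc1 : c < 1)
    (habc : a + b < c) : Set.EqOn (M a b c) (localFormula a b c) (Metric.ball 0 1 \ {0}) := by
  intro z hz
  have hopen : IsOpen (Metric.ball (0 : ℂ) 1 \ {0}) := Metric.isOpen_ball.sdiff isClosed_singleton
  have hc := ((contDiffOn_localFormula ha hb hc1 habc).continuousOn).continuousAt
    (hopen.mem_nhds hz)
  refine extendFrom_eq (dense_doublySlit z) ((hc.tendsto.mono_left nhdsWithin_le_nhds).congr' ?_)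
  filter_upwards [self_mem_nhdsWithin, nhdsWithin_le_nhds (hopen.mem_nhds hz)] with w hw hw'
  exact (denomFormula_eq_localFormula ha hb hc1 habc (by simpa using hw'.1) hw.1).symm

/-! ### Wirtinger derivatives of products $|z|^{2s}h\bar k$ -/

lemma del_congr {f g : ℂ → ℂ} {z : ℂ} (h : f =ᶠ[𝓝 z] g) : del f z = del g z := by
  rw [del, del, h.fderiv_eq]

lemma delbar_congr {f g : ℂ → ℂ} {z : ℂ} (h : f =ᶠ[𝓝 z] g) : delbar f z = delbar g z := by
  rw [delbar, delbar, h.fderiv_eq]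

/-- The real-linear map `v ↦ p v + q v̄`. -/
noncomputable def wirtingerMap (p q : ℂ) : ℂ →L[ℝ] ℂ :=
  p • ContinuousLinearMap.id ℝ ℂ + q • (conjCLE : ℂ →L[ℝ] ℂ)

@[simp] lemma wirtingerMap_apply (p q v : ℂ) : wirtingerMap p q v = p * v + q * conj v := by
  simp [wirtingerMap]

lemma del_eq_of_hasFDerivAt {f : ℂ → ℂ} {p q z : ℂ} (h : HasFDerivAt f (wirtingerMap p q) z) :
    del f z = p := by
  rw [del, h.fderiv]
  simp only [wirtingerMap_apply, map_one, conj_I]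
  linear_combination (-p / 2 + q / 2) * I_mul_I

lemma delbar_eq_of_hasFDerivAt {f : ℂ → ℂ} {p q z : ℂ}
    (h : HasFDerivAt f (wirtingerMap p q) z) : delbar f z = q := by
  rw [delbar, h.fderiv]
  simp only [wirtingerMap_apply, map_one, conj_I]
  linear_combination (p / 2 - q / 2) * I_mul_I

/-- The function `|z| ^ (2 s) h(z) conj (k(z))`. -/
noncomputable def powForm (s : ℝ) (h k : ℂ → ℂ) (z : ℂ) : ℂ :=
  ((‖z‖ ^ (2 * s) : ℝ) : ℂ) * h z * conj (k z)

/-- The operator `h ↦ z ^ (-s) (z ^ s h)'`. -/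
noncomputable def twistedDeriv (s : ℝ) (h : ℂ → ℂ) (z : ℂ) : ℂ := s * h z / z + deriv h z

/-- Formally $|z|^{2s}=z^s\bar z^s$. Working with $(|z|^2)^s$ gives the same derivatives without
choosing a branch. -/
lemma hasFDerivAt_norm_rpow (s : ℝ) {z : ℂ} (hz : z ≠ 0) :
    HasFDerivAt (fun z : ℂ => ((‖z‖ ^ (2 * s) : ℝ) : ℂ))
      (wirtingerMap (((‖z‖ ^ (2 * s) : ℝ) : ℂ) * (s / z))
        (((‖z‖ ^ (2 * s) : ℝ) : ℂ) * conj (s / z))) z := by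
  have hpos : 0 < ‖z‖ := norm_pos_iff.2 hz
  have h1 : HasFDerivAt (fun z : ℂ => ‖z‖ ^ 2) (2 • innerSL ℝ z) z :=
    (hasStrictFDerivAt_norm_sq z).hasFDerivAt
  have h2 := h1.rpow_const (p := s) (Or.inl (by positivity))
  have h3 := ofRealCLM.hasFDerivAt.comp z h2
  have e : ∀ w : ℂ, (‖w‖ ^ 2) ^ s = ‖w‖ ^ (2 * s) := fun w => by
    rw [Real.rpow_mul (norm_nonneg w), Real.rpow_two]
  have e1 : (‖z‖ ^ 2) ^ (s - 1) = ‖z‖ ^ (2 * s) / ‖z‖ ^ 2 := by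
    rw [Real.rpow_sub_one (by positivity), e]
  have e2 : (fun z : ℂ => ((‖z‖ ^ (2 * s) : ℝ) : ℂ)) = ofRealCLM ∘ fun z : ℂ => (‖z‖ ^ 2) ^ s := by
    funext w
    simp [e]
  rw [e2]
  refine h3.congr_fderiv (ContinuousLinearMap.ext fun v => ?_)
  have hinner : ((2 * inner ℝ z v : ℝ) : ℂ) = conj z * v + z * conj v := by
    have := add_conj (conj z * v)
    rw [map_mul, conj_conj] at this
    rw [this, Complex.inner]
    simp [mul_comm]
  have hc : conj z ≠ 0 := by simpa using hz
  have hsq : ((‖z‖ ^ 2 : ℝ) : ℂ) = z * conj z := by rw [mul_conj']; push_cast; rfl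
  have hL : (ofRealCLM.comp ((s * (‖z‖ ^ 2) ^ (s - 1)) • (2 • innerSL ℝ z))) v
      = ((s * (‖z‖ ^ 2) ^ (s - 1) : ℝ) : ℂ) * ((2 * inner ℝ z v : ℝ) : ℂ) := by
    simp
    ring
  rw [hL, hinner, e1, ofReal_mul, ofReal_div, hsq, wirtingerMap_apply]
  simp only [map_div₀, conj_ofReal]
  field_simp

/-- The factor $s/z$ from $|z|^{2s}$ is absorbed into $h$, and its conjugate into $k$. The family is
therefore closed under both Wirtinger derivatives, which act on separate factors and can be iterated
independently. -/
lemma hasFDerivAt_powForm (s : ℝ) {h k : ℂ → ℂ} {z : ℂ} (hz : z ≠ 0)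
    (hh : DifferentiableAt ℂ h z) (hk : DifferentiableAt ℂ k z) :
    HasFDerivAt (powForm s h k)
      (wirtingerMap (powForm s (twistedDeriv s h) k z) (powForm s h (twistedDeriv s k) z)) z := by
  have h1 := hasFDerivAt_norm_rpow s hz
  have h2 := hh.hasDerivAt.hasFDerivAt.restrictScalars ℝ
  have h3 := (conjCLE : ℂ →L[ℝ] ℂ).hasFDerivAt.comp z
    (hk.hasDerivAt.hasFDerivAt.restrictScalars ℝ)
  refine ((h1.mul h2).mul h3).congr_fderiv (ContinuousLinearMap.ext fun v => ?_)
  simp [powForm, twistedDeriv]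
  ring

lemma analyticOnNhd_twistedDeriv (s : ℝ) {h : ℂ → ℂ} {U : Set ℂ} (hU : (0 : ℂ) ∉ U)
    (hh : AnalyticOnNhd ℂ h U) : AnalyticOnNhd ℂ (twistedDeriv s h) U := fun z hz =>
  ((analyticAt_const.mul (hh z hz)).div analyticAt_id fun h0 => hU (by rwa [← h0])).add
    (hh.deriv z hz)

lemma analyticOnNhd_iterate_twistedDeriv (s : ℝ) {h : ℂ → ℂ} {U : Set ℂ} (hU : (0 : ℂ) ∉ U)
    (hh : AnalyticOnNhd ℂ h U) (n : ℕ) : AnalyticOnNhd ℂ ((twistedDeriv s)^[n] h) U := by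
  induction n with
  | zero => exact hh
  | succ n ih =>
    rw [Function.iterate_succ_apply']
    exact analyticOnNhd_twistedDeriv s hU ih

lemma hasFDerivAt_add_powForm (P Q s t : ℝ) {h k h' k' : ℂ → ℂ} {z : ℂ} (hz : z ≠ 0)
    (hh : DifferentiableAt ℂ h z) (hk : DifferentiableAt ℂ k z)
    (hh' : DifferentiableAt ℂ h' z) (hk' : DifferentiableAt ℂ k' z) :
    HasFDerivAt (fun z => (P : ℂ) * powForm s h k z + (Q : ℂ) * powForm t h' k' z)
      (wirtingerMap
        ((P : ℂ) * powForm s (twistedDeriv s h) k z + (Q : ℂ) * powForm t (twistedDeriv t h') k' z)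
        ((P : ℂ) * powForm s h (twistedDeriv s k) z
          + (Q : ℂ) * powForm t h' (twistedDeriv t k') z)) z := by
  refine (((hasFDerivAt_powForm s hz hh hk).const_mul (P : ℂ)).fun_add
    ((hasFDerivAt_powForm t hz hh' hk').const_mul (Q : ℂ))).congr_fderiv
    (ContinuousLinearMap.ext fun v => ?_)
  simp
  ring

lemma iterate_delbar_del_eqOn {P Q s t : ℝ} {f h k : ℂ → ℂ} {U : Set ℂ} (hU : IsOpen U)
    (hU0 : (0 : ℂ) ∉ U) (hh : AnalyticOnNhd ℂ h U) (hk : AnalyticOnNhd ℂ k U)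
    (hf : Set.EqOn f (fun z => (P : ℂ) * powForm s h h z + (Q : ℂ) * powForm t k k z) U)
    (m n : ℕ) :
    Set.EqOn (delbar^[m] (del^[n] f))
      (fun z => (P : ℂ) * powForm s ((twistedDeriv s)^[n] h) ((twistedDeriv s)^[m] h) z
        + (Q : ℂ) * powForm t ((twistedDeriv t)^[n] k) ((twistedDeriv t)^[m] k) z) U := by
  have key : ∀ (m n : ℕ) (z : ℂ), z ∈ U → HasFDerivAt
      (fun z => (P : ℂ) * powForm s ((twistedDeriv s)^[n] h) ((twistedDeriv s)^[m] h) z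
        + (Q : ℂ) * powForm t ((twistedDeriv t)^[n] k) ((twistedDeriv t)^[m] k) z) _ z :=
    fun m n z hz => hasFDerivAt_add_powForm P Q s t (fun h0 => hU0 (by rwa [← h0]))
      (analyticOnNhd_iterate_twistedDeriv s hU0 hh n z hz).differentiableAt
      (analyticOnNhd_iterate_twistedDeriv s hU0 hh m z hz).differentiableAt
      (analyticOnNhd_iterate_twistedDeriv t hU0 hk n z hz).differentiableAt
      (analyticOnNhd_iterate_twistedDeriv t hU0 hk m z hz).differentiableAt
  induction m with
  | zero =>
    induction n with
    | zero => exact hf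
    | succ n ih =>
      intro z hz
      simp only [Function.iterate_zero, id, Function.iterate_succ_apply'] at ih ⊢
      rw [del_congr (ih.eventuallyEq_of_mem (hU.mem_nhds hz))]
      exact del_eq_of_hasFDerivAt (key 0 n z hz)
  | succ m ih =>
    intro z hz
    simp only [Function.iterate_succ_apply']
    rw [delbar_congr (ih.eventuallyEq_of_mem (hU.mem_nhds hz))]
    exact delbar_eq_of_hasFDerivAt (key m n z hz)

/-- If the $n$-th iterate is $g/z^n$, the next one is $\big((s-n)g+zg'\big)/z^{n+1}$. The new
numerator is analytic, and its value at $0$ gains the factor $s-n$. -/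
lemma exists_iterate_twistedDeriv_eq (s : ℝ) {h : ℂ → ℂ} (hh : AnalyticOnNhd ℂ h (Metric.ball 0 1))
    (n : ℕ) : ∃ g : ℂ → ℂ, AnalyticOnNhd ℂ g (Metric.ball 0 1) ∧
      g 0 = ((∏ i ∈ Finset.range n, (s - i) : ℝ) : ℂ) * h 0 ∧
      ∀ z ∈ Metric.ball (0 : ℂ) 1 \ {0}, (twistedDeriv s)^[n] h z = g z / z ^ n := by
  induction n with
  | zero => exact ⟨h, hh, by simp, by simp⟩
  | succ n ih =>
    obtain ⟨g, hg, hg0, hgz⟩ := ih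
    refine ⟨fun z => ((s : ℂ) - n) * g z + z * deriv g z,
      (analyticOnNhd_const.mul hg).add (analyticOnNhd_id.mul hg.deriv), ?_, fun z hz => ?_⟩
    · change ((s : ℂ) - n) * g 0 + 0 * deriv g 0 = _
      rw [Finset.prod_range_succ, hg0]
      push_cast
      ring
    · have hz0 : z ≠ 0 := hz.2
      have hopen : IsOpen (Metric.ball (0 : ℂ) 1 \ {0}) :=
        Metric.isOpen_ball.sdiff isClosed_singleton
      have hev : (twistedDeriv s)^[n] h =ᶠ[𝓝 z] fun z => g z / z ^ n := by
        filter_upwards [hopen.mem_nhds hz] with w hw using hgz w hw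
      have hd : HasDerivAt (fun z => g z / z ^ n) _ z :=
        (hg z hz.1).differentiableAt.hasDerivAt.fun_div (hasDerivAt_pow n z) (pow_ne_zero n hz0)
      rw [Function.iterate_succ_apply', twistedDeriv, hev.deriv_eq, hd.deriv, hgz z hz]
      -- The derivative of $z^n$ carries the truncated exponent $n-1$, so $n=0$ is treated apart.
      rcases n with _ | n
      · field_simp
        simp only [Nat.cast_zero]
        ring
      · simp only [Nat.add_sub_cancel]
        field_simp
        ring

lemma iterate_twistedDeriv_zero (h : ℂ → ℂ) (n : ℕ) : (twistedDeriv 0)^[n] h = deriv^[n] h := by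
  have : twistedDeriv 0 = deriv := by
    funext h z
    simp [twistedDeriv]
  rw [this]

/-- The factor with $i=0$ is $1-c$, and each later one is $-(c+i-1)$. -/
lemma prod_range_one_sub_sub (c : ℝ) {n : ℕ} (hn : 1 ≤ n) :
    ∏ i ∈ Finset.range n, (1 - c - i) = (1 - c) * ((-1) ^ (n - 1) * poch c (n - 1)) := by
  obtain ⟨n, rfl⟩ := Nat.exists_eq_add_of_le' hn
  rw [Nat.add_sub_cancel]
  induction n with
  | zero => simp [poch]
  | succ n ih =>
    rw [Finset.prod_range_succ, ih (by omega), poch, poch, ascPochhammer_succ_eval]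
    push_cast
    ring

/-! ### Asymptotics of the derivatives at the puncture -/

lemma continuousAt_iterate_deriv {h : ℂ → ℂ} (hh : AnalyticOnNhd ℂ h (Metric.ball 0 1)) (n : ℕ) :
    ContinuousAt (deriv^[n] h) 0 :=
  ((hh.iterated_deriv n) 0 (by simp)).continuousAt

lemma punctured_ball_mem_nhdsNE : Metric.ball (0 : ℂ) 1 \ {0} ∈ 𝓝[≠] (0 : ℂ) :=
  sdiff_mem_nhdsWithin_compl (Metric.ball_mem_nhds 0 one_pos) _

lemma tendsto_norm_rpow_nhdsNE {r : ℝ} (hr : 0 < r) :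
    Tendsto (fun z : ℂ => ‖z‖ ^ r) (𝓝[≠] 0) (𝓝 0) := by
  have h : ContinuousAt (fun z : ℂ => ‖z‖ ^ r) 0 :=
    continuousAt_id.norm.rpow_const (Or.inr hr.le)
  simpa [ContinuousAt, Real.zero_rpow hr.ne'] using h.tendsto.mono_left nhdsWithin_le_nhds

/-- The leading behaviour of the mixed Wirtinger derivatives of
`P |h|² + Q |z| ^ (2 s) |k|²` at the puncture. -/
lemma tendsto_iterate_delbar_del {P Q s : ℝ} {f h k : ℂ → ℂ}
    (hh : AnalyticOnNhd ℂ h (Metric.ball 0 1)) (hk : AnalyticOnNhd ℂ k (Metric.ball 0 1))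
    (hf : Set.EqOn f (fun z => (P : ℂ) * powForm 0 h h z + (Q : ℂ) * powForm s k k z)
      (Metric.ball 0 1 \ {0})) {m n : ℕ} (hmn : 0 < (m + n : ℝ) - 2 * s) :
    Tendsto (fun z : ℂ => conj z ^ m * z ^ n * ((‖z‖ ^ (-(2 * s)) : ℝ) : ℂ) *
        (delbar^[m] (del^[n] f)) z) (𝓝[≠] 0)
      (𝓝 ((Q : ℂ) * (((∏ i ∈ Finset.range n, (s - i) : ℝ) : ℂ) * k 0) *
        conj (((∏ i ∈ Finset.range m, (s - i) : ℝ) : ℂ) * k 0))) := by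
  have hopen : IsOpen (Metric.ball (0 : ℂ) 1 \ {0}) := Metric.isOpen_ball.sdiff isClosed_singleton
  have hE := iterate_delbar_del_eqOn hopen (fun h0 => h0.2 rfl) (hh.mono Set.sdiff_subset)
    (hk.mono Set.sdiff_subset) hf m n
  obtain ⟨g₁, hg₁, hg₁0, hg₁z⟩ := exists_iterate_twistedDeriv_eq s hk n
  obtain ⟨g₂, hg₂, hg₂0, hg₂z⟩ := exists_iterate_twistedDeriv_eq s hk m
  have h0 : (0 : ℂ) ∈ Metric.ball (0 : ℂ) 1 := by simp
  have c1 := (hg₁ 0 h0).continuousAt.tendsto.mono_left (nhdsWithin_le_nhds (s := {0}ᶜ))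
  have c2 := (hg₂ 0 h0).continuousAt.tendsto.mono_left (nhdsWithin_le_nhds (s := {0}ᶜ))
  have d1 := (continuousAt_iterate_deriv hh n).tendsto.mono_left (nhdsWithin_le_nhds (s := {0}ᶜ))
  have d2 := (continuousAt_iterate_deriv hh m).tendsto.mono_left (nhdsWithin_le_nhds (s := {0}ᶜ))
  -- The normalising factor has modulus $|z|^{m+n-2s}$, which tends to $0$ by `hmn`. The derivatives
  -- of $|h|^2$ stay bounded, so that part drops out of the limit.
  have hsmall : Tendsto (fun z : ℂ => conj z ^ m * z ^ n * ((‖z‖ ^ (-(2 * s)) : ℝ) : ℂ)) (𝓝[≠] 0)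
      (𝓝 0) := by
    rw [tendsto_zero_iff_norm_tendsto_zero]
    refine (tendsto_norm_rpow_nhdsNE hmn).congr' ?_
    filter_upwards [self_mem_nhdsWithin] with z hz
    have hpos : 0 < ‖z‖ := norm_pos_iff.2 hz
    rw [norm_mul, norm_mul, norm_pow, norm_pow, norm_conj, norm_real,
      Real.norm_of_nonneg (Real.rpow_nonneg hpos.le _), sub_eq_add_neg, Real.rpow_add hpos,
      Real.rpow_add hpos, Real.rpow_natCast, Real.rpow_natCast]
  have hlim := ((hsmall.mul (d1.mul ((continuous_conj.tendsto _).comp d2))).const_mul (P : ℂ)).add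
    ((c1.mul ((continuous_conj.tendsto _).comp c2)).const_mul (Q : ℂ))
  rw [zero_mul, mul_zero, zero_add, hg₁0, hg₂0, ← mul_assoc] at hlim
  refine hlim.congr' ?_
  filter_upwards [punctured_ball_mem_nhdsNE] with z hz
  have hz0 : z ≠ 0 := hz.2
  have hc0 : conj z ≠ 0 := by simpa using hz0
  have hpos : 0 < ‖z‖ := norm_pos_iff.2 hz0
  have hpow : ((‖z‖ ^ (-(2 * s)) : ℝ) : ℂ) * ((‖z‖ ^ (2 * s) : ℝ) : ℂ) = 1 := by
    rw [← ofReal_mul, ← Real.rpow_add hpos, neg_add_cancel, Real.rpow_zero, ofReal_one]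
  rw [hE hz]
  simp only [powForm, iterate_twistedDeriv_zero, hg₁z z hz, hg₂z z hz, mul_zero, Real.rpow_zero,
    ofReal_one, one_mul, map_div₀, map_pow, Function.comp_apply]
  field_simp
  linear_combination -(Q : ℂ) * g₁ z * conj (g₂ z) * hpow

lemma M_eqOn_powForm {a b c : ℝ} (ha : 0 < a) (hb : 0 < b) (hc1 : c < 1) (habc : a + b < c) :
    Set.EqOn (fun z => (M a b c z : ℂ))
      (fun z => ((K₁ a b c - 1 / K₂ a b c : ℝ) : ℂ) * powForm 0 (φ₁ a b c) (φ₁ a b c) z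
        + ((K₂ a b c * (gammaQuot a b c / (1 - c)) ^ 2 : ℝ) : ℂ) *
          powForm (1 - c) (φ₃ a b c) (φ₃ a b c) z) (Metric.ball 0 1 \ {0}) := by
  intro z hz
  simp only [M_eq_localFormula ha hb hc1 habc hz, localFormula, powForm, mul_zero, Real.rpow_zero,
    ofReal_one, one_mul, mul_assoc, mul_conj']
  push_cast
  ring

lemma φ₃_zero (a b c : ℝ) : φ₃ a b c 0 = 1 := by simp [φ₃]

lemma φ₁_zero {a b c : ℝ} (hb : 0 < b) (hcb : 0 < c - b) : φ₁ a b c 0 = 1 := by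
  rw [φ₁_eq_ordinaryHypergeometric hb hcb (by simp)]
  simp

/-- At $z=0$ the hypergeometric equation degenerates to $c\,y'(0)=ab\,y(0)$. -/
lemma deriv_φ₁_zero {a b c : ℝ} (ha : 0 < a) (hb : 0 < b) (hcb : 0 < c - b) :
    deriv (φ₁ a b c) 0 = ((a * b / c : ℝ) : ℂ) := by
  have hc : 0 < c := by linarith
  have hev : φ₁ a b c =ᶠ[𝓝 0] ordinaryHypergeometric (a : ℂ) (b : ℂ) (c : ℂ) := by
    filter_upwards [Metric.ball_mem_nhds (0 : ℂ) one_pos] with z hz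
    exact φ₁_eq_ordinaryHypergeometric hb hcb hz
  have h := (isHypergeometricSolution_ordinaryHypergeometric ha hb hc).eq_zero 0 (by simp)
  rw [hev.deriv_eq]
  simp only [zero_mul, mul_zero, sub_zero, zero_add, ordinaryHypergeometric_zero, mul_one] at h
  have hc' : (c : ℂ) ≠ 0 := by exact_mod_cast hc.ne'
  push_cast
  field_simp
  linear_combination h

lemma tendsto_derivM {a b c : ℝ} (ha : 0 < a) (hb : 0 < b) (hc1 : c < 1) (habc : a + b < c)
    {m n : ℕ} (hmn : 0 < (m + n : ℝ) - 2 * (1 - c)) :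
    Tendsto (fun z : ℂ => conj z ^ m * z ^ n * ((‖z‖ ^ (2 * c - 2) : ℝ) : ℂ) * derivM a b c m n z)
      (𝓝[≠] 0)
      (𝓝 ((K₂ a b c * (gammaQuot a b c / (1 - c)) ^ 2 * (∏ i ∈ Finset.range n, (1 - c - i)) *
        ∏ i ∈ Finset.range m, (1 - c - i) : ℝ) : ℂ)) := by
  have h := tendsto_iterate_delbar_del (φ₁_analyticOnNhd hb (by linarith))
    (φ₃_analyticOnNhd ha hb hc1) (M_eqOn_powForm ha hb hc1 habc) hmn
  simp only [φ₃_zero, mul_one, conj_ofReal] at h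
  rw [show 2 * c - 2 = -(2 * (1 - c)) by ring, ofReal_mul _ (∏ i ∈ Finset.range m, (1 - c - i)),
    ofReal_mul _ (∏ i ∈ Finset.range n, (1 - c - i))]
  exact h

/-- For $c\le\frac12$ the first derivative is outside the range of `tendsto_derivM`. This exact
expression isolates the factor $|z|^{2(1-c)}/z$, of modulus $|z|^{1-2c}$, which decides between
decay and mere boundedness. -/
lemma derivM_zero_one {a b c : ℝ} (ha : 0 < a) (hb : 0 < b) (hc1 : c < 1) (habc : a + b < c)
    {z : ℂ} (hz : z ∈ Metric.ball (0 : ℂ) 1 \ {0}) :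
    derivM a b c 0 1 z = ((K₁ a b c - 1 / K₂ a b c : ℝ) : ℂ) *
        (deriv (φ₁ a b c) z * conj (φ₁ a b c z))
      + ((K₂ a b c * (gammaQuot a b c / (1 - c)) ^ 2 : ℝ) : ℂ) *
        (((‖z‖ ^ (2 * (1 - c)) : ℝ) : ℂ) / z *
          (((1 - c : ℝ) * φ₃ a b c z + z * deriv (φ₃ a b c) z) * conj (φ₃ a b c z))) := by
  have hz0 : z ≠ 0 := hz.2
  have hopen : IsOpen (Metric.ball (0 : ℂ) 1 \ {0}) := Metric.isOpen_ball.sdiff isClosed_singleton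
  have hE := iterate_delbar_del_eqOn hopen (fun h0 => h0.2 rfl)
    ((φ₁_analyticOnNhd (a := a) hb (show 0 < c - b by linarith)).mono Set.sdiff_subset)
    ((φ₃_analyticOnNhd ha hb hc1).mono Set.sdiff_subset) (M_eqOn_powForm ha hb hc1 habc) 0 1 hz
  rw [derivM, hE]
  simp only [Function.iterate_one, Function.iterate_zero, id, powForm, twistedDeriv, mul_zero,
    Real.rpow_zero, ofReal_one, ofReal_zero, zero_mul, zero_div, zero_add, one_mul]
  field_simp

lemma tendsto_derivM_zero_one {a b c : ℝ} (ha : 0 < a) (hb : 0 < b) (habc : a + b < c)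
    (hc : c < 1 / 2) :
    Tendsto (derivM a b c 0 1) (𝓝[≠] 0)
      (𝓝 ((a * b / c * (K₁ a b c - 1 / K₂ a b c) : ℝ) : ℂ)) := by
  have hc1 : c < 1 := by linarith
  have h0 : (0 : ℂ) ∈ Metric.ball (0 : ℂ) 1 := by simp
  have h1 := φ₁_analyticOnNhd (a := a) hb (show 0 < c - b by linarith)
  have h3 := φ₃_analyticOnNhd ha hb hc1
  have c1 := (h1 0 h0).continuousAt.tendsto.mono_left (nhdsWithin_le_nhds (s := {0}ᶜ))
  have c1' := (h1.deriv 0 h0).continuousAt.tendsto.mono_left (nhdsWithin_le_nhds (s := {0}ᶜ))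
  have c3 : ContinuousAt (fun z => ((1 - c : ℝ) * φ₃ a b c z + z * deriv (φ₃ a b c) z) *
      conj (φ₃ a b c z)) 0 := by
    have e3 := (h3 0 h0).continuousAt
    have e3' := (h3.deriv 0 h0).continuousAt
    exact ((continuousAt_const.mul e3).add (continuousAt_id.mul e3')).mul
      (continuous_conj.continuousAt.comp e3)
  have hsmall : Tendsto (fun z : ℂ => ((‖z‖ ^ (2 * (1 - c)) : ℝ) : ℂ) / z) (𝓝[≠] 0) (𝓝 0) := by
    rw [tendsto_zero_iff_norm_tendsto_zero]
    refine (tendsto_norm_rpow_nhdsNE (r := 2 * (1 - c) - 1) (by linarith)).congr' ?_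
    filter_upwards [self_mem_nhdsWithin] with z hz
    have hpos : 0 < ‖z‖ := norm_pos_iff.2 hz
    rw [norm_div, norm_real, Real.norm_of_nonneg (Real.rpow_nonneg hpos.le _),
      Real.rpow_sub_one hpos.ne']
  have hlim := ((c1'.mul ((continuous_conj.tendsto _).comp c1)).const_mul
    ((K₁ a b c - 1 / K₂ a b c : ℝ) : ℂ)).add
    ((hsmall.mul (c3.tendsto.mono_left nhdsWithin_le_nhds)).const_mul
      ((K₂ a b c * (gammaQuot a b c / (1 - c)) ^ 2 : ℝ) : ℂ))
  rw [deriv_φ₁_zero ha hb (by linarith), φ₁_zero hb (by linarith), map_one, mul_one, zero_mul,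
    mul_zero, add_zero, ← ofReal_mul,
    mul_comm (K₁ a b c - 1 / K₂ a b c)] at hlim
  refine hlim.congr' ?_
  filter_upwards [punctured_ball_mem_nhdsNE] with z hz
  exact (derivM_zero_one ha hb hc1 habc hz).symm

/-- At $c=\frac12$ the singular factor is $|z|/z=\bar z/|z|$, bounded but without a limit. The
functions it and the constants multiply are real differentiable at $0$, so replacing them by their
values there costs $O(|z|)$, which is better than required. -/
lemma isBigO_derivM_zero_one {a b c : ℝ} (ha : 0 < a) (hb : 0 < b) (habc : a + b < c)
    (hc : c = 1 / 2) :
    (fun z : ℂ => derivM a b c 0 1 z -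
        (((2 * a * b * (K₁ a b c - 1 / K₂ a b c) : ℝ) : ℂ)
          + ((2 * K₂ a b c * gammaQuot a b c ^ 2 : ℝ) : ℂ) * (conj z / (‖z‖ : ℂ))))
      =O[𝓝[≠] 0] fun z : ℂ => ‖z‖ ^ (1 / 2 : ℝ) := by
  have hc1 : c < 1 := by linarith
  have h0 : (0 : ℂ) ∈ Metric.ball (0 : ℂ) 1 := by simp
  have h1 := φ₁_analyticOnNhd (a := a) hb (show 0 < c - b by linarith)
  have h3 := φ₃_analyticOnNhd ha hb hc1
  have hconj : ∀ {f : ℂ → ℂ}, DifferentiableAt ℂ f 0 → DifferentiableAt ℝ (fun z => conj (f z)) 0 :=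
    fun hf => (conjCLE : ℂ →L[ℝ] ℂ).differentiableAt.comp (0 : ℂ) (hf.restrictScalars ℝ)
  have d1 := (h1 0 h0).differentiableAt
  have d1' := (h1.deriv 0 h0).differentiableAt
  have d3 := (h3 0 h0).differentiableAt
  have d3' := (h3.deriv 0 h0).differentiableAt
  have D1 : DifferentiableAt ℝ (fun z => deriv (φ₁ a b c) z * conj (φ₁ a b c z)) 0 :=
    (d1'.restrictScalars ℝ).mul (hconj d1)
  have D3 : DifferentiableAt ℝ (fun z => ((1 - c : ℝ) * φ₃ a b c z + z * deriv (φ₃ a b c) z) *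
      conj (φ₃ a b c z)) 0 :=
    (((d3.const_mul _).add (differentiableAt_id.mul d3')).restrictScalars ℝ).mul (hconj d3)
  have O1 := D1.isBigO_sub.mono (nhdsWithin_le_nhds (s := {0}ᶜ))
  have O3 := D3.isBigO_sub.mono (nhdsWithin_le_nhds (s := {0}ᶜ))
  simp only [deriv_φ₁_zero ha hb (show 0 < c - b by linarith),
    φ₁_zero (a := a) hb (show 0 < c - b by linarith), φ₃_zero, map_one, mul_one, zero_mul, add_zero,
    sub_zero] at O1 O3
  have hbdd : (fun z : ℂ => conj z / (‖z‖ : ℂ)) =O[𝓝[≠] 0] fun _ => (1 : ℂ) := by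
    refine isBigO_of_le _ fun z => ?_
    rw [norm_div, norm_conj, norm_real, norm_norm, norm_one]
    exact div_self_le_one _
  have hle : (fun z : ℂ => z) =O[𝓝[≠] 0] fun z : ℂ => ‖z‖ ^ (1 / 2 : ℝ) := by
    refine IsBigO.of_bound 1 ?_
    filter_upwards [punctured_ball_mem_nhdsNE] with z hz
    have hpos : 0 < ‖z‖ := norm_pos_iff.2 hz.2
    rw [one_mul, Real.norm_of_nonneg (Real.rpow_nonneg hpos.le _)]
    calc ‖z‖ = ‖z‖ ^ (1 : ℝ) := (Real.rpow_one _).symm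
      _ ≤ ‖z‖ ^ (1 / 2 : ℝ) := Real.rpow_le_rpow_of_exponent_ge hpos
        (by simpa using (mem_ball_zero_iff.1 hz.1).le) (by norm_num)
  have O3' := hbdd.mul O3
  simp only [one_mul] at O3'
  refine (((O1.trans hle).const_mul_left ((K₁ a b c - 1 / K₂ a b c : ℝ) : ℂ)).add
    ((O3'.trans hle).const_mul_left
      ((K₂ a b c * (gammaQuot a b c / (1 - c)) ^ 2 : ℝ) : ℂ))).congr' ?_ EventuallyEq.rfl
  filter_upwards [punctured_ball_mem_nhdsNE] with z hz
  have hz0 : z ≠ 0 := hz.2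
  have hn0 : (‖z‖ : ℂ) ≠ 0 := ofReal_ne_zero.2 (norm_ne_zero_iff.2 hz0)
  have hdiv : ((‖z‖ ^ (2 * (1 - c)) : ℝ) : ℂ) / z = conj z / (‖z‖ : ℂ) := by
    rw [show 2 * (1 - c) = 1 by rw [hc]; norm_num, Real.rpow_one, div_eq_div_iff hz0 hn0, conj_mul',
      sq]
  rw [derivM_zero_one ha hb hc1 habc hz, hdiv]
  generalize conj z / (‖z‖ : ℂ) = e
  -- With $c=\frac12$, $ab/c=2ab$ and $(G/(1-c))^2(1-c)=2G^2$, which gives the two factors $2$ in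
  -- the statement.
  subst hc
  push_cast
  ring

end HypMetric

theorem mainTheorem5 (α β γ : ℝ) (hα0 : 0 < α) (hα1 : α < 1) (hβ0 : 0 < β) (hβ1 : β < 1)
    (hγ0 : 0 < γ) (hγ1 : γ ≤ 1) (hsum : 2 < α + β + γ)
    (a b c : ℝ) (ha : a = (α + β - γ) / 2) (hb : b = (α + β + γ - 2) / 2) (hc : c = α) :
    -- the second expression for `M`
    (∀ z ∈ HypMetric.doublySlit, (HypMetric.M a b c z : ℂ) =
      (HypMetric.K₁ a b c * HypMetric.φ₁ a b c (conj z) + HypMetric.φ₂ a b c (conj z))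
          * HypMetric.φ₁ a b c z
        + (HypMetric.K₂ a b c * HypMetric.φ₂ a b c (conj z) + HypMetric.φ₁ a b c (conj z))
          * HypMetric.φ₂ a b c z) ∧
    -- `M` is smooth near the puncture, so that all the derivatives below are genuine
    ContDiffOn ℝ ∞ (HypMetric.M a b c) (Metric.ball 0 1 \ {0}) ∧
    -- (1)
    (α < 1 / 2 → Tendsto (HypMetric.derivM a b c 0 1) (𝓝[≠] 0)
      (𝓝 ((a * b / c * (HypMetric.K₁ a b c - 1 / HypMetric.K₂ a b c) : ℝ) : ℂ))) ∧
    -- (2)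
    (α = 1 / 2 →
      (fun z : ℂ => HypMetric.derivM a b c 0 1 z -
        (((2 * a * b * (HypMetric.K₁ a b c - 1 / HypMetric.K₂ a b c) : ℝ) : ℂ)
          + ((2 * HypMetric.K₂ a b c * HypMetric.gammaQuot a b c ^ 2 : ℝ) : ℂ)
            * (conj z / (‖z‖ : ℂ))))
        =O[𝓝[≠] 0] fun z : ℂ => ‖z‖ ^ (1 / 2 : ℝ)) ∧
    -- (3)
    (∀ n : ℕ, (2 ≤ n ∧ α ≤ 1 / 2) ∨ (1 ≤ n ∧ 1 / 2 < α) →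
      Tendsto (fun z : ℂ => z ^ n * ((‖z‖ ^ (2 * α - 2) : ℝ) : ℂ) * HypMetric.derivM a b c 0 n z)
        (𝓝[≠] 0)
        (𝓝 (((-1) ^ (n - 1) * HypMetric.poch c (n - 1) * HypMetric.K₂ a b c / (1 - c)
          * HypMetric.gammaQuot a b c ^ 2 : ℝ) : ℂ))) ∧
    -- (4)
    (∀ m n : ℕ, 1 ≤ m → 1 ≤ n →
      Tendsto (fun z : ℂ => conj z ^ m * z ^ n * ((‖z‖ ^ (2 * α - 2) : ℝ) : ℂ)
          * HypMetric.derivM a b c m n z)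
        (𝓝[≠] 0)
        (𝓝 (((-1) ^ (n + m) * HypMetric.poch c (n - 1) * HypMetric.poch c (m - 1)
          * HypMetric.K₂ a b c * HypMetric.gammaQuot a b c ^ 2 : ℝ) : ℂ))) := by
  subst hc
  -- Positivity of $a$ uses $\alpha+\beta>2-\gamma\ge1\ge\gamma$, and $c-a-b=1-\beta>0$.
  have ha0 : 0 < a := by linarith
  have hb0 : 0 < b := by linarith
  have habc : a + b < c := by linarith
  have h1c : 1 - c ≠ 0 := by linarith
  refine ⟨fun z hz => HypMetric.M_eq_add hb0 (by linarith) (by linarith) hz,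
    (HypMetric.contDiffOn_localFormula ha0 hb0 hα1 habc).congr
      (HypMetric.M_eq_localFormula ha0 hb0 hα1 habc),
    HypMetric.tendsto_derivM_zero_one ha0 hb0 habc,
    HypMetric.isBigO_derivM_zero_one ha0 hb0 habc, fun n hn => ?_, fun m n hm hn => ?_⟩
  · have hn1 : 1 ≤ n := by omega
    -- The two alternatives in (3) are precisely the integers $n$ with $n>2(1-c)$.
    have hpos : 0 < ((0 : ℕ) + n : ℝ) - 2 * (1 - c) := by
      rcases hn with ⟨h, -⟩ | ⟨h, h'⟩
      · have : (2 : ℝ) ≤ n := by exact_mod_cast h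
        push_cast
        linarith
      · have : (1 : ℝ) ≤ n := by exact_mod_cast h
        push_cast
        linarith
    have h := HypMetric.tendsto_derivM ha0 hb0 hα1 habc (m := 0) (n := n) hpos
    rw [HypMetric.prod_range_one_sub_sub c hn1] at h
    simp only [pow_zero, one_mul, Finset.range_zero, Finset.prod_empty, mul_one] at h
    convert h using 3
    field_simp
  -- For $m,n\ge1$ domination is automatic: $m+n\ge2>2(1-c)$.
  · have hpos : 0 < (m + n : ℝ) - 2 * (1 - c) := by
      have h1 : (1 : ℝ) ≤ n := by exact_mod_cast hn
      have h2 : (1 : ℝ) ≤ m := by exact_mod_cast hm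
      linarith
    have h := HypMetric.tendsto_derivM ha0 hb0 hα1 habc hpos
    rw [HypMetric.prod_range_one_sub_sub c hn, HypMetric.prod_range_one_sub_sub c hm] at h
    convert h using 3
    have hsign : ((-1 : ℝ)) ^ (n + m) = (-1) ^ (n - 1) * (-1) ^ (m - 1) := by
      rw [← pow_add, show n + m = n - 1 + (m - 1) + 2 by omega, pow_add]
      norm_num
    rw [hsign]
    field_simp
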